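/- For $\alpha,\beta>0$ and $w\in\mathbb{R}^n$ let $Q_w=Q(w;\alpha,\beta)=\sum_{i=1}^n w_iX_i$ with $X_1,\dots,X_n$ i.i.d. $\mathrm{Gamma}(\alpha,\beta)$ (shape $\alpha$, rate $\beta$), and for $\lambda,\phi>0$ let $$\mathcal{Q}_{\mathrm{abs}}(\lambda,\phi;\alpha,\beta)=\{Q_w : n\ge 1,\ w\in\mathbb{R}^n,\ \tfrac1\beta\max_i|w_i|\le\lambda,\ \mathrm{Var}[Q_w]=\phi^2\}.$$ For vectors $u,v$ with nonnegative entries, the shorter one padded with zeros to the common length $N$, write $u\preceq_w v$ if $\sum_{i=1}^k u_{[i]}\le\sum_{i=1}^k v_{[i]}$ for all $k\le N$, where $u_{[1]}\ge u_{[2]}\ge\cdots$ denotes the decreasing rearrangement. For real vectors $\boldsymbol\mu,\boldsymbol\lambda$, with $\boldsymbol\lambda^+=\max(\boldsymbol\lambda,0)$ and $\boldsymbol\lambda^-=\min(\boldsymbol\lambda,0)$ taken entrywise and squares taken entrywise, write $\boldsymbol\mu\preceq_F\boldsymbol\lambda$ if $$(\boldsymbol\mu^+)^2\preceq_w(\boldsymbol\lambda^+)^2,\qquad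 (\boldsymbol\lambda^-)^2\preceq_w(\boldsymbol\mu^-)^2,\qquad \sum_i\mu_i^2=\sum_i\lambda_i^2 .$$ **Theorem.** Fix $\alpha>0$, $\beta>0$ and $0<\lambda\le\phi/\sqrt\alpha$. Let $\hat x_{\mathrm{upper}}\in[-\infty,\infty]$ be the supremum of all inflection points (points of continuity at which the function changes between strictly convex and strictly concave) of the probability density functions of $$Q_w+w_j\psi+w_k\psi'-\mathbb{E}[Q_w],\qquad Q_w\in\mathcal{Q}_{\mathrm{abs}}(\lambda,\phi;\alpha,\beta),\ j\ne k,$$ where $\psi,\psi'$ are i.i.d. $\mathrm{Gamma}(1,\beta)$ (exponential) random variables independent of $Q_w$. If $Q_{\boldsymbol\lambda},Q_{\boldsymbol\mu}\in\mathcal{Q}_{\mathrm{abs}}(\lambda,\phi;\alpha,\beta)$ satisfy $\boldsymbol\mu\preceq_F\boldsymbol\lambda$, then $$\Pr\big(Q_{\boldsymbol\mu}-\mathbb{E}[Q_{\boldsymbol\mu}]\le x\big)\ \ge\ \Pr\big(Q_{\boldsymbol\lambda}-\mathbb{E}[Q_{\boldsymbol\lambda}]\le x\big)\qquad\text{for all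 real } x \text{ with } |x|>\hat x_{\mathrm{upper}} .$$ -/

import Mathlib

open MeasureTheory ProbabilityTheory

noncomputable section

namespace GammaTail

/-- The law of `Q(w; α, β) = ∑ i, w i * X i`, with `X i` i.i.d. Gamma of shape `α` and rate `β`. -/
def QLaw (α β : ℝ) {n : ℕ} (w : Fin n → ℝ) : Measure ℝ :=
  (Measure.pi fun _ : Fin n => gammaMeasure α β).map fun X => ∑ i, w i * X i

/-- `E[Q(w; α, β)]`. -/
def QMean (α β : ℝ) {n : ℕ} (w : Fin n → ℝ) : ℝ :=
  ∫ y, y ∂(QLaw α β w)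

/-- `Pr(Q(w; α, β) - E[Q(w; α, β)] ≤ x)`. -/
def centeredCDF (α β : ℝ) {n : ℕ} (w : Fin n → ℝ) (x : ℝ) : ℝ :=
  (QLaw α β w).real {y | y - QMean α β w ≤ x}

/-- `scale(Q(w; α, β)) = max_i |w i| / β`. -/
def scale (β : ℝ) {n : ℕ} (w : Fin n → ℝ) : ℝ :=
  (⨆ i, |w i|) / β

/-- `Q(w; α, β)` belongs to the family `Q_abs(lam, φ; α, β)`. -/
def MemQAbs (lam φ α β : ℝ) {n : ℕ} (w : Fin n → ℝ) : Prop :=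
  scale β w ≤ lam ∧ variance (fun y : ℝ => y) (QLaw α β w) = φ ^ 2

/-- The law of `Q(w; α, β) + w j * ψ + w k * ψ' - E[Q(w; α, β)]`, where `ψ, ψ'` are i.i.d.
Gamma of shape `1` and rate `β` (exponential), independent of the `X i`. -/
def perturbedLaw (α β : ℝ) {n : ℕ} (w : Fin n → ℝ) (j k : Fin n) : Measure ℝ :=
  ((Measure.pi fun _ : Fin n => gammaMeasure α β).prod
    ((gammaMeasure 1 β).prod (gammaMeasure 1 β))).map
      fun p => (∑ i, w i * p.1 i) + w j * p.2.1 + w k * p.2.2 - QMean α β w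

/-- `p` is an inflection point of `f`: `f` is continuous at `p` and changes there between strictly
convex and strictly concave. Strictness matters: a density that vanishes on a half-line is both
convex and concave there without having inflection points there. -/
def IsInflectionPoint (f : ℝ → ℝ) (p : ℝ) : Prop :=
  ContinuousAt f p ∧ ∃ ε > 0,
    (StrictConvexOn ℝ (Set.Ioo (p - ε) p) f ∧ StrictConcaveOn ℝ (Set.Ioo p (p + ε)) f) ∨
    (StrictConcaveOn ℝ (Set.Ioo (p - ε) p) f ∧ StrictConvexOn ℝ (Set.Ioo p (p + ε)) f)

/-- `f` is a probability density function of `P` with respect to Lebesgue measure. -/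
def IsPDF (P : Measure ℝ) (f : ℝ → ℝ) : Prop :=
  Measurable f ∧ (∀ x, 0 ≤ f x) ∧ P = volume.withDensity fun x => ENNReal.ofReal (f x)

/-- `p` is an inflection point of the density of `P`. The choice of the version of the density is
immaterial: any two versions that have an inflection point at `p` agree near `p`, since
they are continuous there. -/
def IsPDFInflectionPoint (P : Measure ℝ) (p : ℝ) : Prop :=
  ∃ f, IsPDF P f ∧ IsInflectionPoint f p

/-- The supremum, in the extended reals, of the inflection points of the densities of
`Q(w; α, β) + w j * ψ + w k * ψ' - E[Q(w; α, β)]` over all members of `Q_abs(lam, φ; α, β)`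
(of any length `n`) and all `j ≠ k`. -/
def xHatUpper (lam φ α β : ℝ) : EReal :=
  sSup {s : EReal | ∃ (n : ℕ) (w : Fin n → ℝ) (j k : Fin n) (p : ℝ), MemQAbs lam φ α β w ∧ j ≠ k ∧
    IsPDFInflectionPoint (perturbedLaw α β w j k) p ∧ s = (p : EReal)}

/-- The entries of a vector with nonnegative entries in decreasing order, padded with zeros:
`sortedDesc v i` is `v_[i+1]`. -/
def sortedDesc {n : ℕ} (v : Fin n → ℝ) (i : ℕ) : ℝ :=
  ((List.ofFn v).insertionSort (· ≥ ·)).getD i 0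

/-- Weak majorization `u ⪯_w v` of vectors with nonnegative entries, of possibly different
lengths (the shorter one being padded with zeros). -/
def WeakMaj {m n : ℕ} (u : Fin m → ℝ) (v : Fin n → ℝ) : Prop :=
  ∀ k : ℕ, ∑ i ∈ Finset.range k, sortedDesc u i ≤ ∑ i ∈ Finset.range k, sortedDesc v i

/-- The relation `u ⪯_F v`. -/
def FrobMaj {m n : ℕ} (u : Fin m → ℝ) (v : Fin n → ℝ) : Prop :=
  WeakMaj (fun i => (max (u i) 0) ^ 2) (fun i => (max (v i) 0) ^ 2) ∧
  WeakMaj (fun i => (min (v i) 0) ^ 2) (fun i => (min (u i) 0) ^ 2) ∧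
  ∑ i, u i ^ 2 = ∑ i, v i ^ 2

end GammaTail

end

namespace GammaTail

open Set Filter Topology Real
open scoped ENNReal

section GammaLaw

lemma integrable_gammaMeasure_iff {a r : ℝ} (ha : 0 < a) (hr : 0 < r) (f : ℝ → ℝ) :
    Integrable f (gammaMeasure a r) ↔ Integrable (fun x => gammaPDFReal a r x * f x) := by
  rw [gammaMeasure, integrable_withDensity_iff_integrable_smul₀']
  · refine integrable_congr (ae_of_all _ fun x => ?_)
    simp only [gammaPDF, smul_eq_mul]
    rw [ENNReal.toReal_ofReal (gammaPDFReal_nonneg ha hr x)]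
  · exact ((measurable_gammaPDFReal a r).ennreal_ofReal).aemeasurable
  · exact ae_of_all _ fun x => ENNReal.ofReal_lt_top

lemma integral_gammaMeasure_eq_gammaPDFReal {a r : ℝ} (ha : 0 < a) (hr : 0 < r) (f : ℝ → ℝ) :
    ∫ x, f x ∂gammaMeasure a r = ∫ x, gammaPDFReal a r x * f x := by
  rw [gammaMeasure, integral_withDensity_eq_integral_toReal_smul₀]
  · refine integral_congr_ae (ae_of_all _ fun x => ?_)
    simp only [gammaPDF, smul_eq_mul]
    rw [ENNReal.toReal_ofReal (gammaPDFReal_nonneg ha hr x)]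
  · exact ((measurable_gammaPDFReal a r).ennreal_ofReal).aemeasurable
  · exact ae_of_all _ fun x => ENNReal.ofReal_lt_top

lemma mul_gammaPDFReal {a r : ℝ} (ha : 0 < a) (hr : 0 < r) (x : ℝ) :
    gammaPDFReal a r x * x = a / r * gammaPDFReal (a + 1) r x := by
  unfold gammaPDFReal
  rcases lt_trichotomy x 0 with hx | rfl | hx
  · simp [hx.not_ge]
  · simp [zero_rpow ha.ne']
  · have hG := (Gamma_pos_of_pos ha).ne'
    simp only [hx.le, if_true, add_sub_cancel_right]
    rw [Gamma_add_one ha.ne', rpow_add_one hr.ne', rpow_sub_one hx.ne']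
    field_simp

/-- Size-biasing a gamma law raises its shape by one. -/
lemma integral_mul_gammaMeasure {a r : ℝ} (ha : 0 < a) (hr : 0 < r) (f : ℝ → ℝ) :
    ∫ x, x * f x ∂gammaMeasure a r = a / r * ∫ x, f x ∂gammaMeasure (a + 1) r := by
  rw [integral_gammaMeasure_eq_gammaPDFReal ha hr,
    integral_gammaMeasure_eq_gammaPDFReal (by linarith) hr, ← integral_const_mul]
  refine integral_congr_ae (ae_of_all _ fun x => ?_)
  simp only
  rw [← mul_assoc, mul_gammaPDFReal ha hr, mul_assoc]

lemma integrable_mul_gammaMeasure {a r : ℝ} (ha : 0 < a) (hr : 0 < r) {f : ℝ → ℝ}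
    (hf : Integrable f (gammaMeasure (a + 1) r)) :
    Integrable (fun x => x * f x) (gammaMeasure a r) := by
  rw [integrable_gammaMeasure_iff ha hr]
  rw [integrable_gammaMeasure_iff (by linarith) hr] at hf
  refine (hf.const_mul (a / r)).congr (ae_of_all _ fun x => ?_)
  simp only
  rw [← mul_assoc, ← mul_gammaPDFReal ha hr, mul_assoc]

lemma integrable_id_gammaMeasure {a r : ℝ} (ha : 0 < a) (hr : 0 < r) :
    Integrable (fun x : ℝ => x) (gammaMeasure a r) := by
  have := isProbabilityMeasure_gammaMeasure (a := a + 1) (r := r) (by linarith) hr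
  simpa using integrable_mul_gammaMeasure ha hr (integrable_const (1 : ℝ))

lemma integral_id_gammaMeasure {a r : ℝ} (ha : 0 < a) (hr : 0 < r) :
    ∫ x, x ∂gammaMeasure a r = a / r := by
  have := isProbabilityMeasure_gammaMeasure (a := a + 1) (r := r) (by linarith) hr
  simpa using integral_mul_gammaMeasure ha hr (fun _ => 1)

lemma memLp_two_gammaMeasure {a r : ℝ} (ha : 0 < a) (hr : 0 < r) :
    MemLp (fun x : ℝ => x) 2 (gammaMeasure a r) := by
  rw [memLp_two_iff_integrable_sq (by fun_prop)]
  refine (integrable_mul_gammaMeasure ha hr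
    (integrable_id_gammaMeasure (by linarith) hr)).congr (ae_of_all _ fun x => ?_)
  simp [sq]

lemma variance_gammaMeasure {a r : ℝ} (ha : 0 < a) (hr : 0 < r) :
    Var[fun x : ℝ => x; gammaMeasure a r] = a / r ^ 2 := by
  have := isProbabilityMeasure_gammaMeasure ha hr
  rw [variance_eq_sub (memLp_two_gammaMeasure ha hr)]
  have : ∫ x, ((fun x : ℝ => x) ^ 2) x ∂gammaMeasure a r = a / r * ((a + 1) / r) := by
    rw [← integral_id_gammaMeasure (a := a + 1) (by linarith) hr, ← integral_mul_gammaMeasure ha hr]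
    refine integral_congr_ae (ae_of_all _ fun x => ?_)
    simp [sq]
  rw [this, integral_id_gammaMeasure ha hr]
  field_simp
  ring

/-- Stein's identity for the gamma law. -/
lemma gamma_stein {a r : ℝ} (ha : 0 < a) (hr : 0 < r) {G G' : ℝ → ℝ} {C : ℝ}
    (hG : ∀ x, HasDerivAt G (G' x) x) (hG' : Continuous G') (hC : ∀ x, |G x| ≤ C)
    (hC' : ∀ x, |G' x| ≤ C) :
    ∫ x, (x - a / r) * G x ∂gammaMeasure a r = a / r ^ 2 * ∫ x, G' x ∂gammaMeasure (a + 1) r := by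
  have := isProbabilityMeasure_gammaMeasure ha hr
  have ha1 : 0 < a + 1 := by linarith
  have := isProbabilityMeasure_gammaMeasure ha1 hr
  have hGc : Continuous G := continuous_iff_continuousAt.2 fun x => (hG x).continuousAt
  have iG : ∀ μ : Measure ℝ, IsProbabilityMeasure μ → Integrable G μ := fun μ _ =>
    Integrable.of_bound hGc.aestronglyMeasurable C (ae_of_all _ fun x => hC x)
  have iG' : ∀ μ : Measure ℝ, IsProbabilityMeasure μ → Integrable G' μ := fun μ _ =>
    Integrable.of_bound hG'.aestronglyMeasurable C (ae_of_all _ fun x => hC' x)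
  set c := r ^ (a + 1) / Gamma (a + 1) with hc
  set u : ℝ → ℝ := fun x => c * x ^ a * exp (-(r * x)) * G x with hu
  set u' : ℝ → ℝ := fun x => gammaPDFReal (a + 1) r x * G' x
    + (r * (gammaPDFReal a r x * G x) - r * (gammaPDFReal (a + 1) r x * G x)) with hu'
  have key : ∫ x in Ioi 0, u' x = 0 - u 0 := by
    apply integral_Ioi_of_hasDerivAt_of_tendsto
    · have : ContinuousAt u 0 := by
        have : Continuous fun x : ℝ => x ^ a := continuous_rpow_const ha.le
        exact Continuous.continuousAt (by fun_prop)
      exact this.continuousWithinAt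
    · intro x hx
      have hx : 0 < x := hx
      have h1 : HasDerivAt (fun x : ℝ => c * x ^ a * exp (-(r * x)))
          (c * (a * x ^ (a - 1)) * exp (-(r * x)) + c * x ^ a * (exp (-(r * x)) * -(r * 1))) x :=
        ((hasDerivAt_rpow_const (Or.inl hx.ne')).const_mul c).mul
          ((((hasDerivAt_id x).const_mul r).neg).exp)
      refine (h1.mul (hG x)).congr_deriv ?_
      simp only [hu', gammaPDFReal, hx.le, if_true, hc, add_sub_cancel_right]
      rw [Gamma_add_one ha.ne', rpow_add_one hr.ne']
      have hGp := (Gamma_pos_of_pos ha).ne'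
      field_simp
      ring
    · have j1 := ((integrable_gammaMeasure_iff ha1 hr _).1 (iG' _ inferInstance))
      have j2 := ((integrable_gammaMeasure_iff ha hr _).1 (iG _ inferInstance))
      have j3 := ((integrable_gammaMeasure_iff ha1 hr _).1 (iG _ inferInstance))
      exact (j1.add ((j2.const_mul r).sub (j3.const_mul r))).integrableOn
    · have h0 : Tendsto (fun x : ℝ => c * (x ^ a * exp (-r * x)) * C) atTop (𝓝 0) := by
        simpa using ((tendsto_rpow_mul_exp_neg_mul_atTop_nhds_zero a r hr).const_mul c).mul_const C
      refine squeeze_zero_norm' ?_ h0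
      filter_upwards [eventually_gt_atTop 0] with x hx
      have : 0 ≤ c * (x ^ a * exp (-r * x)) := by
        have := Gamma_pos_of_pos ha1
        positivity
      simp only [hu, norm_mul, norm_eq_abs]
      rw [← abs_mul, ← abs_mul, show c * x ^ a * exp (-(r * x)) = c * (x ^ a * exp (-r * x)) by
        rw [neg_mul, mul_assoc], abs_of_nonneg this]
      exact mul_le_mul_of_nonneg_left (hC x) this
  have hu0 : u 0 = 0 := by simp [hu, zero_rpow ha.ne']
  have key2 : ∫ x, u' x = 0 := by
    rw [hu0, sub_zero, ← integral_Ici_eq_integral_Ioi, ← integral_indicator measurableSet_Ici]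
      at key
    rw [← key]
    refine integral_congr_ae (ae_of_all _ fun x => ?_)
    by_cases hx : 0 ≤ x
    · simp [hx]
    · simp [hx, hu', gammaPDFReal]
  have j1 := ((integrable_gammaMeasure_iff ha1 hr _).1 (iG' _ inferInstance))
  have j2 := ((integrable_gammaMeasure_iff ha hr _).1 (iG _ inferInstance))
  have j3 := ((integrable_gammaMeasure_iff ha1 hr _).1 (iG _ inferInstance))
  have j4 : Integrable fun x => r * (gammaPDFReal a r x * G x)
      - r * (gammaPDFReal (a + 1) r x * G x) := (j2.const_mul r).sub (j3.const_mul r)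
  rw [hu', integral_add j1 j4, integral_sub (j2.const_mul r) (j3.const_mul r),
    integral_const_mul, integral_const_mul,
    ← integral_gammaMeasure_eq_gammaPDFReal ha1 hr, ← integral_gammaMeasure_eq_gammaPDFReal ha hr,
    ← integral_gammaMeasure_eq_gammaPDFReal ha1 hr] at key2
  have e1 : ∫ x, (x - a / r) * G x ∂gammaMeasure a r =
      a / r * ∫ x, G x ∂gammaMeasure (a + 1) r - a / r * ∫ x, G x ∂gammaMeasure a r := by
    rw [← integral_mul_gammaMeasure ha hr, ← integral_const_mul, ← integral_sub]
    · refine integral_congr_ae (ae_of_all _ fun x => ?_)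
      simp only; ring
    · exact integrable_mul_gammaMeasure ha hr (iG _ inferInstance)
    · exact (iG _ inferInstance).const_mul _
  rw [e1]
  have : ∫ x, G' x ∂gammaMeasure (a + 1) r =
    r * ∫ x, G x ∂gammaMeasure (a + 1) r - r * ∫ x, G x ∂gammaMeasure a r := by linarith
  rw [this]
  field_simp

/-- Stein's identity for the exponential law. -/
lemma exp_stein {r : ℝ} (hr : 0 < r) {G G' : ℝ → ℝ} {C : ℝ}
    (hG : ∀ x, HasDerivAt G (G' x) x) (hG' : Continuous G') (hC : ∀ x, |G x| ≤ C)
    (hC' : ∀ x, |G' x| ≤ C) :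
    ∫ x, G x ∂gammaMeasure 1 r = G 0 + 1 / r * ∫ x, G' x ∂gammaMeasure 1 r := by
  have := isProbabilityMeasure_gammaMeasure one_pos hr
  have hGc : Continuous G := continuous_iff_continuousAt.2 fun x => (hG x).continuousAt
  have iG : Integrable G (gammaMeasure 1 r) :=
    Integrable.of_bound hGc.aestronglyMeasurable C (ae_of_all _ fun x => hC x)
  have iG' : Integrable G' (gammaMeasure 1 r) :=
    Integrable.of_bound hG'.aestronglyMeasurable C (ae_of_all _ fun x => hC' x)
  have j1 := (integrable_gammaMeasure_iff one_pos hr _).1 iG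
  have j2 := (integrable_gammaMeasure_iff one_pos hr _).1 iG'
  set u : ℝ → ℝ := fun x => exp (-(r * x)) * G x with hu
  set u' : ℝ → ℝ := fun x => r⁻¹ * (gammaPDFReal 1 r x * G' x) - gammaPDFReal 1 r x * G x with hu'
  have key : ∫ x in Ioi 0, u' x = 0 - u 0 := by
    apply integral_Ioi_of_hasDerivAt_of_tendsto
    · exact Continuous.continuousWithinAt (by fun_prop)
    · intro x hx
      have hx : 0 < x := hx
      refine (((((hasDerivAt_id x).const_mul r).neg).exp).mul (hG x)).congr_deriv ?_
      simp only [hu', gammaPDFReal, hx.le, if_true, id]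
      simp
      field_simp
      ring
    · exact ((j2.const_mul _).sub j1).integrableOn
    · have h0 : Tendsto (fun x : ℝ => (x ^ (0 : ℝ) * exp (-r * x)) * C) atTop (𝓝 0) := by
        simpa using (tendsto_rpow_mul_exp_neg_mul_atTop_nhds_zero 0 r hr).mul_const C
      refine squeeze_zero_norm (fun x => ?_) h0
      simp only [hu, norm_mul, norm_eq_abs, abs_exp, rpow_zero, one_mul, neg_mul]
      exact mul_le_mul_of_nonneg_left (hC x) (exp_pos _).le
  have key2 : ∫ x, u' x = - G 0 := by
    have hu0 : u 0 = G 0 := by simp [hu]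
    rw [hu0, zero_sub, ← integral_Ici_eq_integral_Ioi, ← integral_indicator measurableSet_Ici]
      at key
    rw [← key]
    refine integral_congr_ae (ae_of_all _ fun x => ?_)
    by_cases hx : 0 ≤ x
    · simp [hx]
    · simp [hx, hu', gammaPDFReal]
  rw [hu', integral_sub (j2.const_mul _) j1, integral_const_mul,
    ← integral_gammaMeasure_eq_gammaPDFReal one_pos hr,
    ← integral_gammaMeasure_eq_gammaPDFReal one_pos hr] at key2
  rw [one_div]; linarith

end GammaLaw

section BetaGamma

/-- The unnormalized gamma density. -/
noncomputable def gammaKernel (a b y : ℝ) : ℝ≥0∞ :=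
  ENNReal.ofReal (y ^ (a - 1) * exp (-(b * y)))

lemma measurable_gammaKernel (a : ℝ) : Measurable fun p : ℝ × ℝ => gammaKernel a p.1 p.2 := by
  unfold gammaKernel; fun_prop

@[fun_prop]
lemma Measurable.gammaKernel {Ω : Type*} [MeasurableSpace Ω] (a : ℝ) {f g : Ω → ℝ}
    (hf : Measurable f) (hg : Measurable g) : Measurable fun x => gammaKernel a (f x) (g x) :=
  (measurable_gammaKernel a).comp (hf.prodMk hg)

lemma lintegral_gammaMeasure {a r : ℝ} (ha : 0 < a) (hr : 0 < r) {F : ℝ → ℝ≥0∞}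
    (hF : Measurable F) :
    ∫⁻ x, F x ∂gammaMeasure a r =
      ENNReal.ofReal (r ^ a / Gamma a) * ∫⁻ x in Ioi 0, gammaKernel a r x * F x := by
  have hm : Measurable (gammaPDF a r) := (measurable_gammaPDFReal a r).ennreal_ofReal
  rw [gammaMeasure, lintegral_withDensity_eq_lintegral_mul _ hm hF,
    ← lintegral_const_mul _ (by fun_prop), ← lintegral_indicator measurableSet_Ioi]
  refine lintegral_congr_ae ?_
  have h0 : ∀ᵐ x : ℝ, x ≠ 0 := by simp [ae_iff]
  filter_upwards [h0] with x hx0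
  by_cases hx : 0 < x
  · have := Gamma_pos_of_pos ha
    simp only [Pi.mul_apply, indicator, mem_Ioi, hx, if_true, gammaPDF_of_nonneg hx.le,
      gammaKernel]
    rw [← mul_assoc, ← ENNReal.ofReal_mul (by positivity), mul_assoc]
  · have : x < 0 := lt_of_le_of_ne (not_lt.1 hx) hx0
    simp [gammaPDF_of_neg this, hx]

lemma setLIntegral_Ioo_eq_mul {v : ℝ} (hv : 0 < v) {F : ℝ → ℝ≥0∞} (hF : Measurable F) :
    ∫⁻ x in Ioo 0 v, F x = ENNReal.ofReal v * ∫⁻ s in Ioo (0 : ℝ) 1, F (v * s) := by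
  have h := Real.smul_map_volume_mul_left hv.ne'
  conv_lhs => rw [← h]
  rw [Measure.restrict_smul, lintegral_smul_measure, abs_of_pos hv,
    setLIntegral_map measurableSet_Ioo hF (by fun_prop), smul_eq_mul]
  congr 2
  have : (fun x => v * x) ⁻¹' Ioo 0 v = Ioo 0 1 := by
    ext s
    simp only [mem_preimage, mem_Ioo]
    constructor
    · rintro ⟨h1, h2⟩
      exact ⟨pos_of_mul_pos_right h1 hv.le, by nlinarith⟩
    · rintro ⟨h1, h2⟩
      exact ⟨by positivity, by nlinarith⟩
  rw [this]

/-- The beta-gamma algebra: the convolution of two gamma kernels is a mixture of gamma kernels. -/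
lemma lintegral_gammaKernel_conv (a₁ a₂ b₁ b₂ : ℝ) {F : ℝ → ℝ≥0∞} (hF : Measurable F) :
    ∫⁻ x in Ioi 0, gammaKernel a₁ b₁ x * ∫⁻ y in Ioi 0, gammaKernel a₂ b₂ y * F (x + y) =
      ∫⁻ s in Ioo (0 : ℝ) 1, ENNReal.ofReal (s ^ (a₁ - 1) * (1 - s) ^ (a₂ - 1)) *
        ∫⁻ v in Ioi 0, gammaKernel (a₁ + a₂) (b₁ * s + b₂ * (1 - s)) v * F v := by
  have hT : MeasurableSet {p : ℝ × ℝ | 0 < p.1 ∧ p.1 < p.2} :=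
    (measurableSet_lt measurable_const measurable_fst).inter
      (measurableSet_lt measurable_fst measurable_snd)
  let H : ℝ × ℝ → ℝ≥0∞ := {p : ℝ × ℝ | 0 < p.1 ∧ p.1 < p.2}.indicator
    fun p => gammaKernel a₁ b₁ p.1 * (gammaKernel a₂ b₂ (p.2 - p.1) * F p.2)
  have hH : Measurable H := Measurable.indicator (by fun_prop) hT
  have e1 : ∫⁻ x in Ioi 0, gammaKernel a₁ b₁ x * ∫⁻ y in Ioi 0, gammaKernel a₂ b₂ y * F (x + y) =
      ∫⁻ x, ∫⁻ v, H (x, v) := by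
    rw [← lintegral_indicator measurableSet_Ioi]
    refine lintegral_congr fun x => ?_
    by_cases hx : 0 < x
    · rw [indicator_of_mem (by exact hx), ← lintegral_const_mul _ (by fun_prop),
        ← lintegral_indicator measurableSet_Ioi, ← lintegral_sub_right_eq_self _ x]
      refine lintegral_congr fun v => ?_
      by_cases hv : x < v
      · simp [H, hx, hv]
      · simp [H, hv]
    · simp [H, hx]
  have e2 : ∀ v, ∫⁻ x, H (x, v) = (Ioi 0).indicator (fun v => ∫⁻ s in Ioo (0 : ℝ) 1,
      ENNReal.ofReal (s ^ (a₁ - 1) * (1 - s) ^ (a₂ - 1)) *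
        (gammaKernel (a₁ + a₂) (b₁ * s + b₂ * (1 - s)) v * F v)) v := by
    intro v
    by_cases hv : 0 < v
    · rw [indicator_of_mem (by exact hv)]
      have : ∫⁻ x, H (x, v) = ∫⁻ x in Ioo 0 v,
          gammaKernel a₁ b₁ x * (gammaKernel a₂ b₂ (v - x) * F v) := by
        rw [← lintegral_indicator measurableSet_Ioo]
        refine lintegral_congr fun x => ?_
        simp only [H, indicator, mem_ofPred_eq, mem_Ioo]
      rw [this, setLIntegral_Ioo_eq_mul hv (by fun_prop), ← lintegral_const_mul _ (by fun_prop)]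
      refine setLIntegral_congr_fun measurableSet_Ioo fun s hs => ?_
      rw [← mul_assoc, ← mul_assoc, ← mul_assoc]
      congr 1
      have h1 : 0 < 1 - s := by linarith [hs.2]
      have h2 := hs.1
      unfold gammaKernel
      rw [← ENNReal.ofReal_mul hv.le, ← ENNReal.ofReal_mul (by positivity),
        ← ENNReal.ofReal_mul (by positivity)]
      congr 1
      rw [show v - v * s = v * (1 - s) by ring, mul_rpow hv.le h2.le, mul_rpow hv.le h1.le,
        show a₁ + a₂ - 1 = 1 + (a₁ - 1) + (a₂ - 1) by ring, rpow_add hv, rpow_add hv, rpow_one,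
        show -((b₁ * s + b₂ * (1 - s)) * v) = -(b₁ * (v * s)) + -(b₂ * (v * (1 - s))) by ring,
        exp_add]
      ring
    · rw [indicator_of_notMem (by exact hv)]
      have : ∀ x, H (x, v) = 0 := fun x => by
        simp only [H, indicator, mem_ofPred_eq]
        rw [if_neg]
        rintro ⟨h1, h2⟩
        exact hv (h1.trans h2)
      simp [this]
  rw [e1, lintegral_lintegral_swap (by fun_prop)]
  simp_rw [e2]
  rw [lintegral_indicator measurableSet_Ioi, lintegral_lintegral_swap (by fun_prop)]
  refine lintegral_congr fun s => ?_
  rw [lintegral_const_mul _ (by fun_prop)]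

lemma gammaMeasure_conv_one {a r : ℝ} (ha : 0 < a) (hr : 0 < r) :
    gammaMeasure a r ∗ gammaMeasure 1 r = gammaMeasure (a + 1) r := by
  have := isProbabilityMeasure_gammaMeasure ha hr
  have := isProbabilityMeasure_gammaMeasure one_pos hr
  have ha1 : 0 < a + 1 := by linarith
  have := isProbabilityMeasure_gammaMeasure ha1 hr
  have key : ∃ c : ℝ≥0∞, ∀ F : ℝ → ℝ≥0∞, Measurable F →
      ∫⁻ x, F x ∂(gammaMeasure a r ∗ gammaMeasure 1 r) =
        c * ∫⁻ x, F x ∂gammaMeasure (a + 1) r := by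
    have hG : 0 < r ^ (a + 1) / Gamma (a + 1) := by
      have := Gamma_pos_of_pos ha1
      positivity
    refine ⟨ENNReal.ofReal (r ^ a / Gamma a) * ENNReal.ofReal (r ^ (1 : ℝ) / Gamma 1) *
      (∫⁻ s in Ioo (0 : ℝ) 1, ENNReal.ofReal (s ^ (a - 1) * (1 - s) ^ ((1 : ℝ) - 1))) *
      (ENNReal.ofReal (r ^ (a + 1) / Gamma (a + 1)))⁻¹, fun F hF => ?_⟩
    rw [Measure.lintegral_conv hF]
    simp_rw [fun x => lintegral_gammaMeasure one_pos hr (F := fun y => F (x + y)) (by fun_prop)]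
    rw [lintegral_const_mul _ (by fun_prop), lintegral_gammaMeasure ha hr (by fun_prop),
      lintegral_gammaKernel_conv _ _ _ _ hF, lintegral_gammaMeasure ha1 hr hF]
    simp_rw [show ∀ s : ℝ, r * s + r * (1 - s) = r by intro s; ring]
    rw [lintegral_mul_const _ (by fun_prop)]
    rw [mul_assoc (_ * _ * _), ← mul_assoc _⁻¹, ENNReal.inv_mul_cancel
      (by simpa using hG) ENNReal.ofReal_ne_top, one_mul]
    ring
  obtain ⟨c, hc⟩ := key
  have h1 := hc (fun _ => 1) measurable_const
  simp only [lintegral_const, measure_univ, mul_one] at h1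
  ext s hs
  have := hc (s.indicator 1) (measurable_const.indicator hs)
  rwa [lintegral_indicator_one hs, lintegral_indicator_one hs, ← h1, one_mul] at this

end BetaGamma

section Mixture

/-- `P` is the law of `Y + R`, where, up to a weight, `Y` is a gamma variable of a fixed shape and
of a random rate bounded away from zero, and `R ≤ 0`. -/
def IsGammaMixture (P : Measure ℝ) : Prop :=
  ∃ (a b₀ : ℝ) (ν : Measure (ℝ × ℝ)), 0 < a ∧ 0 < b₀ ∧ IsFiniteMeasure ν ∧
    (∀ᵐ p ∂ν, b₀ ≤ p.1 ∧ p.2 ≤ 0) ∧ ∀ F : ℝ → ℝ≥0∞, Measurable F →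
      ∫⁻ y, F y ∂P = ∫⁻ p, (∫⁻ y in Ioi 0, gammaKernel a p.1 y * F (y + p.2)) ∂ν

lemma isGammaMixture_gammaMeasure {a r : ℝ} (ha : 0 < a) (hr : 0 < r) :
    IsGammaMixture (gammaMeasure a r) := by
  refine ⟨a, r, ENNReal.ofReal (r ^ a / Gamma a) • Measure.dirac (r, 0), ha, hr, ?_, ?_, ?_⟩
  · exact Measure.smul_finite _ ENNReal.ofReal_ne_top
  · exact Measure.ae_smul_measure (by simp [ae_dirac_eq]) _
  · intro F hF
    rw [lintegral_smul_measure, lintegral_dirac' _ (by fun_prop), lintegral_gammaMeasure ha hr hF]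
    simp

lemma IsGammaMixture.conv_gammaMeasure {P : Measure ℝ} [SFinite P] (hP : IsGammaMixture P)
    {a r : ℝ} (ha : 0 < a) (hr : 0 < r) : IsGammaMixture (P ∗ gammaMeasure a r) := by
  obtain ⟨a₀, b₀, ν, ha₀, hb₀, hν, hae, hF⟩ := hP
  have := isProbabilityMeasure_gammaMeasure ha hr
  let D : ℝ → ℝ≥0∞ := fun s => ENNReal.ofReal (s ^ (a₀ - 1) * (1 - s) ^ (a - 1))
  let κ : Measure ℝ := ENNReal.ofReal (r ^ a / Gamma a) • (volume.restrict (Ioo 0 1)).withDensity D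
  have hD : Measurable D := by fun_prop
  have hκ : IsFiniteMeasure κ := by
    have : IsFiniteMeasure ((volume.restrict (Ioo (0 : ℝ) 1)).withDensity D) := by
      refine isFiniteMeasure_withDensity ?_
      have h1 := lintegral_betaPDF_eq_one ha₀ ha
      rw [lintegral_betaPDF] at h1
      have hB := beta_pos ha₀ ha
      have : ∫⁻ s in Ioo (0 : ℝ) 1, D s = ENNReal.ofReal (beta a₀ a) * ∫⁻ (x : ℝ) in Ioo 0 1,
          ENNReal.ofReal (1 / beta a₀ a * x ^ (a₀ - 1) * (1 - x) ^ (a - 1)) := by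
        rw [← lintegral_const_mul _ (by fun_prop)]
        refine lintegral_congr fun s => ?_
        rw [← ENNReal.ofReal_mul hB.le]
        simp only [D]
        congr 1
        field_simp
      rw [this, h1, mul_one]
      exact ENNReal.ofReal_ne_top
    exact Measure.smul_finite _ ENNReal.ofReal_ne_top
  let g : (ℝ × ℝ) × ℝ → ℝ × ℝ := fun q => (q.1.1 * q.2 + r * (1 - q.2), q.1.2)
  have hg : Measurable g := by fun_prop
  refine ⟨a₀ + a, min b₀ r, (ν.prod κ).map g, by positivity, by positivity, inferInstance, ?_, ?_⟩
  · have hs : ∀ᵐ s ∂κ, s ∈ Ioo (0 : ℝ) 1 :=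
      Measure.ae_smul_measure ((withDensity_absolutelyContinuous _ _).ae_le
        (ae_restrict_mem measurableSet_Ioo)) _
    have hmeas : MeasurableSet {p : ℝ × ℝ | min b₀ r ≤ p.1 ∧ p.2 ≤ 0} :=
      (measurableSet_le measurable_const measurable_fst).inter
        (measurableSet_le measurable_snd measurable_const)
    rw [ae_map_iff hg.aemeasurable hmeas]
    refine (Measure.ae_prod_iff_ae_ae (hg hmeas)).2 ?_
    filter_upwards [hae] with p hp
    filter_upwards [hs] with s hs
    refine ⟨?_, hp.2⟩
    have h1 : min b₀ r ≤ p.1 := (min_le_left _ _).trans hp.1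
    have h2 : min b₀ r ≤ r := min_le_right _ _
    have := hs.1
    have := hs.2
    simp only [g]
    nlinarith
  · intro F hFm
    rw [Measure.lintegral_conv hFm, hF _ (by fun_prop), lintegral_map (by fun_prop) hg,
      lintegral_prod _ (by fun_prop)]
    refine lintegral_congr fun p => ?_
    simp_rw [fun x => lintegral_gammaMeasure ha hr (F := fun y => F (x + y)) (by fun_prop)]
    simp only [κ, g]
    rw [lintegral_smul_measure, lintegral_withDensity_eq_lintegral_mul _ hD (by fun_prop),
      smul_eq_mul]
    have := lintegral_gammaKernel_conv a₀ a p.1 r (F := fun v => F (v + p.2)) (by fun_prop)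
    simp only [Pi.mul_apply, D]
    rw [← this, ← lintegral_const_mul _ (by fun_prop)]
    refine lintegral_congr fun x => ?_
    rw [← mul_assoc, mul_comm (gammaKernel _ _ _), mul_assoc]
    simp only [add_right_comm]

lemma IsGammaMixture.conv_nonpos {P N : Measure ℝ} [IsFiniteMeasure N] (hP : IsGammaMixture P)
    (hN : ∀ᵐ x ∂N, x ≤ 0) : IsGammaMixture (P ∗ N) := by
  obtain ⟨a₀, b₀, ν, ha₀, hb₀, hν, hae, hF⟩ := hP
  let g : (ℝ × ℝ) × ℝ → ℝ × ℝ := fun q => (q.1.1, q.2 + q.1.2)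
  have hg : Measurable g := by fun_prop
  refine ⟨a₀, b₀, (ν.prod N).map g, ha₀, hb₀, inferInstance, ?_, ?_⟩
  · have hmeas : MeasurableSet {p : ℝ × ℝ | b₀ ≤ p.1 ∧ p.2 ≤ 0} :=
      (measurableSet_le measurable_const measurable_fst).inter
        (measurableSet_le measurable_snd measurable_const)
    rw [ae_map_iff hg.aemeasurable hmeas]
    refine (Measure.ae_prod_iff_ae_ae (hg hmeas)).2 ?_
    filter_upwards [hae] with p hp
    filter_upwards [hN] with s hs
    exact ⟨hp.1, by simp only [g]; linarith [hp.2]⟩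
  · intro F hFm
    rw [Measure.lintegral_conv hFm, hF _ (by fun_prop), lintegral_map (by fun_prop) hg,
      lintegral_prod _ (by fun_prop)]
    refine lintegral_congr fun p => ?_
    simp only [g]
    rw [lintegral_lintegral_swap (by fun_prop)]
    refine lintegral_congr fun x => ?_
    rw [lintegral_const_mul _ (by fun_prop)]
    simp only [add_right_comm, add_assoc]

lemma map_mul_gammaMeasure {a r w : ℝ} (ha : 0 < a) (hr : 0 < r) (hw : 0 < w) :
    (gammaMeasure a r).map (fun x => w * x) = gammaMeasure a (r / w) := by
  ext s hs
  rw [← lintegral_indicator_one hs, ← lintegral_indicator_one hs]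
  set F : ℝ → ℝ≥0∞ := s.indicator 1 with hFd
  have hF : Measurable F := measurable_const.indicator hs
  rw [lintegral_map hF (by fun_prop), lintegral_gammaMeasure ha hr (by fun_prop), lintegral_gammaMeasure ha (by positivity) hF]
  have h := Real.smul_map_volume_mul_left hw.ne'
  conv_rhs => rw [← h]
  rw [Measure.restrict_smul, lintegral_smul_measure, abs_of_pos hw,
    setLIntegral_map measurableSet_Ioi (by fun_prop) (by fun_prop), smul_eq_mul]
  have : (fun x => w * x) ⁻¹' Ioi 0 = Ioi 0 := by
    ext s; simp [hw]
  rw [this, ← mul_assoc, ← lintegral_const_mul _ (by fun_prop),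
    ← lintegral_const_mul _ (by fun_prop)]
  refine setLIntegral_congr_fun measurableSet_Ioi fun x hx => ?_
  have hx : 0 < x := hx
  rw [← mul_assoc, ← mul_assoc]
  congr 1
  have hG := Gamma_pos_of_pos ha
  unfold gammaKernel
  rw [← ENNReal.ofReal_mul (by positivity), ← ENNReal.ofReal_mul (by positivity),
    ← ENNReal.ofReal_mul (by positivity)]
  congr 1
  rw [mul_rpow hw.le hx.le, div_rpow hr.le hw.le, show r / w * (w * x) = r * x by field_simp,
    rpow_sub_one hw.ne']
  field_simp

lemma gammaMeasure_nonneg_ae (a r : ℝ) : ∀ᵐ x ∂gammaMeasure a r, 0 ≤ x := by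
  rw [ae_iff, gammaMeasure, withDensity_apply _ (by measurability)]
  have : {x : ℝ | ¬ 0 ≤ x} = Iio 0 := by ext; simp
  rw [this, lintegral_gammaPDF_of_nonpos le_rfl]

lemma IsGammaMixture.conv_map_mul {P : Measure ℝ} [SFinite P] (hP : IsGammaMixture P)
    {a r : ℝ} (ha : 0 < a) (hr : 0 < r) (w : ℝ) :
    IsGammaMixture (P ∗ (gammaMeasure a r).map fun x => w * x) := by
  have := isProbabilityMeasure_gammaMeasure ha hr
  rcases le_or_gt w 0 with hw | hw
  · refine hP.conv_nonpos ?_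
    rw [ae_map_iff (by fun_prop) measurableSet_Iic]
    filter_upwards [gammaMeasure_nonneg_ae a r] with x hx
    exact mul_nonpos_of_nonpos_of_nonneg hw hx
  · rw [map_mul_gammaMeasure ha hr hw]
    exact hP.conv_gammaMeasure ha (by positivity)

lemma exists_bound_rpow_mul_exp (c : ℝ) {b δ : ℝ} (hb : 0 < b) (hδ : 0 < δ) :
    ∃ M : ℝ, ∀ y, δ ≤ y → y ^ c * exp (-(b * y)) ≤ M := by
  have h := tendsto_rpow_mul_exp_neg_mul_atTop_nhds_zero c b hb
  obtain ⟨Y, hY⟩ := (h.eventually_le_const one_pos).exists_forall_of_atTop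
  have hc : ContinuousOn (fun y : ℝ => y ^ c * exp (-(b * y))) (Icc δ Y) := by
    refine ContinuousOn.mul (fun y hy => ?_) (by fun_prop)
    exact (continuousAt_rpow_const _ _ (Or.inl (hδ.trans_le hy.1).ne')).continuousWithinAt
  obtain ⟨C, hC⟩ := isCompact_Icc.exists_bound_of_continuousOn hc
  refine ⟨max C 1, fun y hy => ?_⟩
  rcases le_total y Y with h1 | h1
  · exact ((le_abs_self _).trans (hC y ⟨hy, h1⟩)).trans (le_max_left _ _)
  · have := hY y h1
    rw [neg_mul] at this
    exact this.trans (le_max_right _ _)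

/-- The gamma kernel on the complex half-plane. -/
noncomputable def cKernel (a : ℝ) (z : ℂ) (p : ℝ × ℝ) : ℂ :=
  (z - p.2) ^ ((a - 1 : ℝ) : ℂ) * Complex.exp (-(p.1 * (z - p.2)))

lemma hasDerivAt_cKernel (a : ℝ) {z : ℂ} (hz : 0 < z.re) {p : ℝ × ℝ} (hp : p.2 ≤ 0) :
    HasDerivAt (fun z => cKernel a z p)
      (((a - 1 : ℝ) : ℂ) * (z - p.2) ^ (((a - 1 : ℝ) : ℂ) - 1) * 1 *
        Complex.exp (-(p.1 * (z - p.2))) + (z - p.2) ^ ((a - 1 : ℝ) : ℂ) *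
        (Complex.exp (-(p.1 * (z - p.2))) * (-(p.1 * 1)))) z := by
  have h0 : HasDerivAt (fun z : ℂ => z - p.2) 1 z := (hasDerivAt_id z).sub_const _
  refine (h0.cpow_const (Or.inl ?_)).mul ((h0.const_mul (p.1 : ℂ)).neg.cexp)
  simp only [Complex.sub_re, Complex.ofReal_re]
  linarith

lemma exists_bound_cKernel (a : ℝ) {b₀ δ : ℝ} (hb : 0 < b₀) (hδ : 0 < δ) (R : ℝ) :
    ∃ M : ℝ, ∀ (z : ℂ) (p : ℝ × ℝ), δ ≤ z.re → ‖z‖ ≤ R → b₀ ≤ p.1 → p.2 ≤ 0 →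
      ‖cKernel a z p‖ ≤ M := by
  obtain ⟨M, hM⟩ := exists_bound_rpow_mul_exp (a - 1) hb hδ
  refine ⟨exp (b₀ * R) * M, fun z p hz hR hp hr => ?_⟩
  have h1 : δ ≤ ‖z - p.2‖ := by
    refine le_trans ?_ (Complex.re_le_norm _)
    simp only [Complex.sub_re, Complex.ofReal_re]; linarith
  have h2 : ‖z - p.2‖ ≤ R - p.2 := by
    refine (norm_sub_le _ _).trans ?_
    rw [Complex.norm_real, norm_eq_abs, abs_of_nonpos hr]; linarith
  unfold cKernel
  rw [norm_mul, Complex.norm_cpow_real, Complex.norm_exp]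
  have h3 : (-(p.1 * (z - p.2)) : ℂ).re ≤ b₀ * R + -(b₀ * ‖z - p.2‖) := by
    simp only [Complex.neg_re, Complex.mul_re, Complex.ofReal_re, Complex.sub_re,
      Complex.ofReal_im, zero_mul, sub_zero]
    nlinarith
  calc ‖z - p.2‖ ^ (a - 1) * exp (-(p.1 * (z - p.2)) : ℂ).re
      ≤ ‖z - p.2‖ ^ (a - 1) * exp (b₀ * R + -(b₀ * ‖z - p.2‖)) := by gcongr
    _ = exp (b₀ * R) * (‖z - p.2‖ ^ (a - 1) * exp (-(b₀ * ‖z - p.2‖))) := by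
        rw [exp_add]; ring
    _ ≤ _ := by gcongr; exact hM _ h1

lemma differentiableAt_integral_cKernel (a : ℝ) {b₀ : ℝ} (hb : 0 < b₀) {ν : Measure (ℝ × ℝ)}
    [IsFiniteMeasure ν] (hν : ∀ᵐ p ∂ν, b₀ ≤ p.1 ∧ p.2 ≤ 0) {z₀ : ℂ} (hz₀ : 0 < z₀.re) :
    DifferentiableAt ℂ (fun z => ∫ p, cKernel a z p ∂ν) z₀ := by
  set δ := z₀.re / 2 with hδ
  have hδp : 0 < δ := by positivity
  obtain ⟨M, hM⟩ := exists_bound_cKernel a hb hδp (‖z₀‖ + δ)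
  have hmem : ∀ z : ℂ, dist z z₀ ≤ δ → δ ≤ z.re ∧ ‖z‖ ≤ ‖z₀‖ + δ := by
    intro z hz
    rw [dist_eq_norm] at hz
    constructor
    · have := (Complex.abs_re_le_norm (z - z₀)).trans hz
      rw [Complex.sub_re, abs_le] at this
      linarith [this.1]
    · have := norm_sub_norm_le z z₀
      linarith
  have hmeas : ∀ z, AEStronglyMeasurable (fun p => cKernel a z p) ν := fun z => by
    refine Measurable.aestronglyMeasurable ?_
    unfold cKernel; fun_prop
  refine (hasDerivAt_integral_of_dominated_loc_of_deriv_le (F := cKernel a)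
    (bound := fun _ => M / (δ / 2))
    (F' := fun z p => ((a - 1 : ℝ) : ℂ) * (z - p.2) ^ (((a - 1 : ℝ) : ℂ) - 1) * 1 *
        Complex.exp (-(p.1 * (z - p.2))) + (z - p.2) ^ ((a - 1 : ℝ) : ℂ) *
        (Complex.exp (-(p.1 * (z - p.2))) * (-(p.1 * 1))))
    (Metric.ball_mem_nhds z₀ (half_pos hδp)) (Eventually.of_forall hmeas) ?_ ?_ ?_
    (integrable_const _) ?_).2.differentiableAt
  · refine Integrable.of_bound (hmeas z₀) M ?_
    filter_upwards [hν] with p hp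
    have := hmem z₀ (by simpa using hδp.le)
    exact hM z₀ p this.1 this.2 hp.1 hp.2
  · exact Measurable.aestronglyMeasurable (by fun_prop)
  · filter_upwards [hν] with p hp z hz
    have hz : dist z z₀ < δ / 2 := hz
    have hre := (hmem z (by linarith)).1
    rw [← (hasDerivAt_cKernel a (hδp.trans_le hre) hp.2).deriv]
    have hball : ∀ y, dist y z ≤ δ / 2 → dist y z₀ ≤ δ := fun y hy => by
      linarith [dist_triangle y z z₀]
    refine Complex.norm_deriv_le_of_forall_mem_sphere_norm_le (half_pos hδp) ?_ fun y hy => ?_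
    · refine DifferentiableOn.diffContOnCl fun y hy => ?_
      have hy := Metric.closure_ball_subset_closedBall hy
      have h2 := hmem y (hball y hy)
      exact (hasDerivAt_cKernel a (hδp.trans_le h2.1) hp.2).differentiableAt.differentiableWithinAt
    · have h2 := hmem y (hball y (Metric.sphere_subset_closedBall hy))
      exact hM y p h2.1 h2.2 hp.1 hp.2
  · filter_upwards [hν] with p hp z hz
    have hz : dist z z₀ < δ / 2 := hz
    exact hasDerivAt_cKernel a (hδp.trans_le (hmem z (by linarith)).1) hp.2

/-- A gamma mixture has a density that is real-analytic on the positive half-line. -/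
lemma IsGammaMixture.exists_pdf {P : Measure ℝ} [IsFiniteMeasure P] (hP : IsGammaMixture P) :
    ∃ f, IsPDF P f ∧ ∀ x, 0 < x → AnalyticAt ℝ f x := by
  obtain ⟨a, b₀, ν, ha, hb, hν, hae, hF⟩ := hP
  let K : ℝ × (ℝ × ℝ) → ℝ≥0∞ := {q : ℝ × (ℝ × ℝ) | q.2.2 < q.1}.indicator
    fun q => gammaKernel a q.2.1 (q.1 - q.2.2)
  have hK : Measurable K :=
    Measurable.indicator (by fun_prop) (measurableSet_lt (by fun_prop) (by fun_prop))
  let d : ℝ → ℝ≥0∞ := fun x => ∫⁻ p, K (x, p) ∂ν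
  have hd : Measurable d := hK.lintegral_prod_right'
  have hPd : P = volume.withDensity d := by
    ext s hs
    have h1 : Measurable (s.indicator (1 : ℝ → ℝ≥0∞)) := measurable_const.indicator hs
    rw [withDensity_apply _ hs, ← lintegral_indicator_one hs, hF _ h1, ← lintegral_indicator hs]
    have : ∀ x, s.indicator d x = ∫⁻ p, K (x, p) * s.indicator 1 x ∂ν := by
      intro x
      rw [lintegral_mul_const _ (by fun_prop)]
      by_cases hx : x ∈ s <;> simp [hx, d]
    simp_rw [this]
    rw [lintegral_lintegral_swap (μ := volume) (by fun_prop)]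
    refine lintegral_congr fun p => ?_
    rw [← lintegral_indicator measurableSet_Ioi, ← lintegral_sub_right_eq_self _ p.2]
    refine lintegral_congr fun x => ?_
    by_cases hx : p.2 < x
    · simp [K, hx]
    · simp [K, hx]
  have hfin : ∀ᵐ x, d x < ∞ := by
    refine ae_lt_top hd ?_
    have : ∫⁻ x, d x = P univ := by rw [hPd, withDensity_apply _ MeasurableSet.univ]; simp
    rw [this]; exact measure_ne_top _ _
  refine ⟨fun x => (d x).toReal, ⟨hd.ennreal_toReal, fun x => ENNReal.toReal_nonneg, ?_⟩, ?_⟩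
  · rw [hPd]
    refine withDensity_congr_ae ?_
    filter_upwards [hfin] with x hx
    rw [ENNReal.ofReal_toReal hx.ne]
  · intro x hx
    have hC : AnalyticAt ℂ (fun z => ∫ p, cKernel a z p ∂ν) (x : ℂ) := by
      have hopen : IsOpen {z : ℂ | 0 < z.re} := isOpen_lt continuous_const Complex.continuous_re
      refine DifferentiableOn.analyticAt (s := {z : ℂ | 0 < z.re}) (fun z hz => ?_)
        (hopen.mem_nhds (by simpa using hx))
      exact (differentiableAt_integral_cKernel a hb hae hz).differentiableWithinAt
    refine hC.re_ofReal.congr ?_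
    filter_upwards [lt_mem_nhds hx] with y hy
    have h1 : ∀ᵐ p ∂ν, cKernel a (y : ℂ) p =
        (((y - p.2) ^ (a - 1) * exp (-(p.1 * (y - p.2))) : ℝ) : ℂ) := by
      filter_upwards [hae] with p hp
      unfold cKernel
      rw [Complex.ofReal_mul, Complex.ofReal_cpow (by linarith [hp.2])]
      push_cast
      rfl
    rw [integral_congr_ae h1, integral_complex_ofReal, Complex.ofReal_re,
      integral_eq_lintegral_of_nonneg_ae]
    · congr 1
      refine lintegral_congr_ae ?_
      filter_upwards [hae] with p hp
      have : p.2 < y := by linarith [hp.2]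
      simp [K, this, gammaKernel]
    · filter_upwards [hae] with p hp
      have : 0 < y - p.2 := by linarith [hp.2]
      simp only [Pi.zero_apply]
      positivity
    · exact Measurable.aestronglyMeasurable (by fun_prop)

end Mixture

section Laws

variable {α β : ℝ} {n : ℕ}

lemma measurable_linearForm (w : Fin n → ℝ) :
    Measurable fun X : Fin n → ℝ => ∑ i, w i * X i := by fun_prop

lemma isProbabilityMeasure_QLaw (hα : 0 < α) (hβ : 0 < β) (w : Fin n → ℝ) :
    IsProbabilityMeasure (QLaw α β w) := by
  have := isProbabilityMeasure_gammaMeasure hα hβ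
  exact Measure.isProbabilityMeasure_map (measurable_linearForm w).aemeasurable

lemma QLaw_succAbove (hα : 0 < α) (hβ : 0 < β) (w : Fin (n + 1) → ℝ) (i : Fin (n + 1)) :
    QLaw α β w =
      ((gammaMeasure α β).map fun x => w i * x) ∗ QLaw α β fun j => w (i.succAbove j) := by
  have := isProbabilityMeasure_gammaMeasure hα hβ
  have h := measurePreserving_piFinSuccAbove (fun _ : Fin (n + 1) => gammaMeasure α β) i
  unfold QLaw Measure.conv
  rw [Measure.map_prod_map _ _ (by fun_prop) (by fun_prop), ← h.map_eq,
    Measure.map_map (by fun_prop) (by fun_prop), Measure.map_map (by fun_prop) (by fun_prop)]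
  congr 1
  ext X
  simp [Fin.sum_univ_succAbove _ i, MeasurableEquiv.piFinSuccAbove, Fin.insertNthEquiv,
    Fin.removeNth]

lemma QLaw_zero (w : Fin 0 → ℝ) (hα : 0 < α) (hβ : 0 < β) : QLaw α β w = Measure.dirac 0 := by
  have := isProbabilityMeasure_gammaMeasure hα hβ
  unfold QLaw
  simp

lemma IsGammaMixture.conv_QLaw {P : Measure ℝ} [IsFiniteMeasure P] (hP : IsGammaMixture P)
    (hα : 0 < α) (hβ : 0 < β) (w : Fin n → ℝ) : IsGammaMixture (P ∗ QLaw α β w) := by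
  have := isProbabilityMeasure_gammaMeasure hα hβ
  induction n generalizing P with
  | zero => rw [QLaw_zero w hα hβ, Measure.conv_dirac_zero]; exact hP
  | succ n ih =>
    have := isProbabilityMeasure_QLaw hα hβ fun j => w ((0 : Fin (n + 1)).succAbove j)
    rw [QLaw_succAbove hα hβ w 0, ← Measure.conv_assoc]
    exact ih (hP.conv_map_mul hα hβ _) _

lemma isGammaMixture_QLaw (hα : 0 < α) (hβ : 0 < β) {w : Fin n → ℝ} (hw : ∃ i, 0 < w i) :
    IsGammaMixture (QLaw α β w) := by
  have := isProbabilityMeasure_gammaMeasure hα hβ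
  obtain ⟨i, hi⟩ := hw
  cases n with
  | zero => exact i.elim0
  | succ n =>
    rw [QLaw_succAbove hα hβ w i]
    refine IsGammaMixture.conv_QLaw ?_ hα hβ _
    rw [map_mul_gammaMeasure hα hβ hi]
    exact isGammaMixture_gammaMeasure hα (by positivity)

lemma perturbedLaw_eq (hα : 0 < α) (hβ : 0 < β) (w : Fin n → ℝ) (j k : Fin n) :
    perturbedLaw α β w j k = ((QLaw α β w ∗ ((gammaMeasure 1 β).map fun x => w j * x)) ∗
      ((gammaMeasure 1 β).map fun x => w k * x)).map fun y => y - QMean α β w := by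
  have := isProbabilityMeasure_gammaMeasure hα hβ
  have := isProbabilityMeasure_gammaMeasure one_pos hβ
  have := isProbabilityMeasure_QLaw hα hβ w
  have h : ((gammaMeasure 1 β).map fun x => w j * x) ∗ ((gammaMeasure 1 β).map fun x => w k * x) =
      ((gammaMeasure 1 β).prod (gammaMeasure 1 β)).map fun q => w j * q.1 + w k * q.2 := by
    unfold Measure.conv
    rw [Measure.map_prod_map _ _ (by fun_prop) (by fun_prop),
      Measure.map_map (by fun_prop) (by fun_prop)]
    rfl
  rw [Measure.conv_assoc, h]
  unfold perturbedLaw QLaw Measure.conv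
  rw [Measure.map_prod_map _ _ (by fun_prop) (by fun_prop),
    Measure.map_map (by fun_prop) (by fun_prop), Measure.map_map (by fun_prop) (by fun_prop)]
  congr 1
  ext p
  simp [add_assoc]

lemma isProbabilityMeasure_perturbedLaw (hα : 0 < α) (hβ : 0 < β) (w : Fin n → ℝ) (j k : Fin n) :
    IsProbabilityMeasure (perturbedLaw α β w j k) := by
  have := isProbabilityMeasure_gammaMeasure hα hβ
  have := isProbabilityMeasure_gammaMeasure one_pos hβ
  exact Measure.isProbabilityMeasure_map (by fun_prop)

lemma IsPDF.map_sub {P : Measure ℝ} {f : ℝ → ℝ} (hf : IsPDF P f) (c : ℝ) :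
    IsPDF (P.map fun y => y - c) fun x => f (x + c) := by
  obtain ⟨hm, h0, hP⟩ := hf
  refine ⟨by fun_prop, fun x => h0 _, ?_⟩
  ext s hs
  have hs' : MeasurableSet ((fun y => y - c) ⁻¹' s) := hs.preimage (by fun_prop)
  rw [Measure.map_apply (by fun_prop) hs, hP, withDensity_apply _ hs', withDensity_apply _ hs,
    ← lintegral_indicator hs', ← lintegral_indicator hs, ← lintegral_add_right_eq_self _ c]
  refine lintegral_congr fun x => ?_
  by_cases hx : x ∈ s <;> simp [hx]

lemma exists_pdf_perturbedLaw (hα : 0 < α) (hβ : 0 < β) {w : Fin n → ℝ} (hw : ∃ i, 0 < w i)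
    (j k : Fin n) : ∃ f, IsPDF (perturbedLaw α β w j k) f ∧
      ∀ x, -QMean α β w < x → AnalyticAt ℝ f x := by
  have := isProbabilityMeasure_gammaMeasure one_pos hβ
  have := isProbabilityMeasure_QLaw hα hβ w
  obtain ⟨f, hf, han⟩ := (((isGammaMixture_QLaw hα hβ hw).conv_map_mul one_pos hβ
    (w j)).conv_map_mul one_pos hβ (w k)).exists_pdf
  refine ⟨fun x => f (x + QMean α β w), ?_, fun x hx => ?_⟩
  · rw [perturbedLaw_eq hα hβ]
    exact hf.map_sub _
  · exact AnalyticAt.fun_comp (han _ (by linarith)) (by fun_prop)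

end Laws

section Inflection

lemma exists_deriv2_pos {f : ℝ → ℝ} {c x₀ : ℝ} (hc : c < x₀) (hf0 : ∀ x, 0 ≤ f x)
    (hint : Integrable f) (han : ∀ x, c < x → AnalyticAt ℝ f x)
    (hneg : deriv (deriv f) x₀ < 0) : ∃ x₁, x₀ < x₁ ∧ 0 < deriv (deriv f) x₁ := by
  by_contra! hcon
  have hd : ∀ x, x₀ ≤ x → DifferentiableAt ℝ f x := fun x hx =>
    (han x (hc.trans_le hx)).differentiableAt
  have hd' : ∀ x, x₀ ≤ x → DifferentiableAt ℝ (deriv f) x := fun x hx =>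
    (han x (hc.trans_le hx)).deriv.differentiableAt
  have anti : AntitoneOn (deriv f) (Ici x₀) := by
    refine antitoneOn_of_deriv_nonpos (convex_Ici _)
      (fun x hx => (hd' x hx).continuousAt.continuousWithinAt)
      (fun x hx => (hd' x (interior_subset hx)).differentiableWithinAt) fun x hx => ?_
    rw [interior_Ici] at hx
    exact hcon x hx
  have hpos : ∀ y, x₀ ≤ y → 0 ≤ deriv f y := by
    intro y hy
    by_contra! hy0
    set x := y + (f y + 1) / (-deriv f y) with hx
    have hfy := hf0 y
    have hxy : y ≤ x := by
      have : 0 ≤ (f y + 1) / (-deriv f y) := div_nonneg (by linarith) (by linarith)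
      linarith
    have := Convex.image_sub_le_mul_sub_of_deriv_le (convex_Ici y)
      (fun z hz => (hd z (hy.trans hz)).continuousAt.continuousWithinAt)
      (fun z hz => (hd z (hy.trans (interior_subset hz))).differentiableWithinAt)
      (C := deriv f y) (fun z hz => anti (by exact hy) (hy.trans (interior_subset hz))
        (interior_subset hz)) y self_mem_Ici x hxy hxy
    have e : deriv f y * (x - y) = -(f y + 1) := by
      rw [hx]; have := hy0.ne; field_simp; ring
    rw [e] at this
    linarith [hf0 x]
  have mono : MonotoneOn f (Ici x₀) := by
    refine monotoneOn_of_deriv_nonneg (convex_Ici _)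
      (fun x hx => (hd x hx).continuousAt.continuousWithinAt)
      (fun x hx => (hd x (interior_subset hx)).differentiableWithinAt) fun x hx => ?_
    exact hpos x (interior_subset hx)
  have hzero : ∀ y, x₀ ≤ y → f y = 0 := by
    intro y hy
    by_contra hne
    have hy0 : 0 < f y := lt_of_le_of_ne (hf0 y) (Ne.symm hne)
    have h1 := hint.measure_ge_lt_top hy0
    have h2 : volume (Ici y) ≤ volume {a | f y ≤ f a} :=
      measure_mono fun z hz => mono (by exact hy) (by exact hy.trans hz) hz
    simp only [Real.volume_Ici, top_le_iff] at h2
    rw [h2] at h1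
    exact lt_irrefl _ h1
  have hcont : ContinuousAt (deriv (deriv f)) x₀ := (han x₀ hc).deriv.deriv.continuousAt
  obtain ⟨ε, hε, hball⟩ := Metric.eventually_nhds_iff.1 (hcont.eventually_lt_const hneg)
  have h3 := hball (y := x₀ + ε / 2) (by
    rw [dist_eq, add_sub_cancel_left, abs_of_pos (by linarith)]; linarith)
  have h4 : f =ᶠ[𝓝 (x₀ + ε / 2)] fun _ => 0 := by
    filter_upwards [lt_mem_nhds (show x₀ < x₀ + ε / 2 by linarith)] with y hy
    exact hzero y hy.le
  rw [h4.deriv.deriv_eq] at h3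
  simp at h3

/-- A nonnegative integrable function that is analytic on a half-line and strictly concave
somewhere on it has an inflection point further to the right. -/
lemma exists_inflectionPoint {f : ℝ → ℝ} {c x₀ : ℝ} (hc : c < x₀) (hf0 : ∀ x, 0 ≤ f x)
    (hint : Integrable f) (han : ∀ x, c < x → AnalyticAt ℝ f x)
    (hneg : deriv (deriv f) x₀ < 0) : ∃ p, x₀ ≤ p ∧ IsInflectionPoint f p := by
  obtain ⟨x₁, hx₁, hpos⟩ := exists_deriv2_pos hc hf0 hint han hneg
  set d := deriv (deriv f) with hd
  have hdan : ∀ x, c < x → AnalyticAt ℝ d x := fun x hx => (han x hx).deriv.deriv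
  set S := {x | x ∈ Icc x₀ x₁ ∧ d x < 0} with hS
  have hx₀S : x₀ ∈ S := ⟨⟨le_rfl, hx₁.le⟩, hneg⟩
  have hbdd : BddAbove S := ⟨x₁, fun x hx => hx.1.2⟩
  set p := sSup S with hp
  have hx₀p : x₀ ≤ p := le_csSup hbdd hx₀S
  have hpx₁ : p ≤ x₁ := csSup_le ⟨x₀, hx₀S⟩ fun x hx => hx.1.2
  have hcp : c < p := hc.trans_le hx₀p
  have hcont : ContinuousAt d p := (hdan p hcp).continuousAt
  have hdp0 : d p ≤ 0 := by
    by_contra! h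
    obtain ⟨ε, hε, hball⟩ := Metric.eventually_nhds_iff.1 (hcont.eventually_const_lt h)
    obtain ⟨x, hxS, hx⟩ := exists_lt_of_lt_csSup ⟨x₀, hx₀S⟩ (show p - ε < sSup S by linarith)
    have hxp : x ≤ p := le_csSup hbdd hxS
    have := hball (y := x) (by rw [dist_eq, abs_lt]; constructor <;> linarith)
    linarith [hxS.2]
  have hpx₁' : p < x₁ := lt_of_le_of_ne hpx₁ fun h => by rw [h] at hdp0; linarith
  have hdp : d p = 0 := by
    refine le_antisymm hdp0 ?_
    by_contra! h
    obtain ⟨ε, hε, hball⟩ := Metric.eventually_nhds_iff.1 (hcont.eventually_lt_const h)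
    set x := min x₁ (p + ε / 2) with hx
    have hxp : p < x := lt_min hpx₁' (by linarith)
    have hxε : x ≤ p + ε / 2 := min_le_right _ _
    have h2 := hball (y := x) (by rw [dist_eq, abs_lt]; constructor <;> linarith)
    have : x ≤ p := le_csSup hbdd ⟨⟨hx₀p.trans hxp.le, min_le_left _ _⟩, h2⟩
    linarith
  have hleft : ∀ ε > 0, ∃ x, p - ε < x ∧ x < p ∧ d x < 0 := by
    intro ε hε
    obtain ⟨x, hxS, hx⟩ := exists_lt_of_lt_csSup ⟨x₀, hx₀S⟩ (show p - ε < sSup S by linarith)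
    have hxp : x ≤ p := le_csSup hbdd hxS
    refine ⟨x, hx, lt_of_le_of_ne hxp fun h => ?_, hxS.2⟩
    have := hxS.2
    rw [h, hdp] at this
    exact lt_irrefl _ this
  have hright : ∀ x, p < x → x < x₁ → 0 ≤ d x := by
    intro x h1 h2
    by_contra! h
    exact absurd (le_csSup hbdd ⟨⟨hx₀p.trans h1.le, h2.le⟩, h⟩) (not_le.2 h1)
  have hne : ∀ᶠ z in 𝓝[≠] p, d z ≠ 0 := by
    rcases (hdan p hcp).eventually_eq_zero_or_eventually_ne_zero with h | h
    · obtain ⟨ε, hε, hball⟩ := Metric.eventually_nhds_iff.1 h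
      obtain ⟨x, h1, h2, h3⟩ := hleft ε hε
      have := hball (y := x) (by rw [dist_eq, abs_lt]; constructor <;> linarith)
      linarith
    · exact h
  rw [eventually_nhdsWithin_iff] at hne
  obtain ⟨ε₀, hε₀, hball⟩ := Metric.eventually_nhds_iff.1 hne
  set ε := min ε₀ (min (p - c) (x₁ - p)) with hε
  have hεp : 0 < ε := lt_min hε₀ (lt_min (by linarith) (by linarith))
  have h1 : ε ≤ ε₀ := min_le_left _ _
  have h2 : ε ≤ p - c := (min_le_right _ _).trans (min_le_left _ _)
  have h3 : ε ≤ x₁ - p := (min_le_right _ _).trans (min_le_right _ _)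
  have hnz : ∀ x, p - ε < x → x < p + ε → x ≠ p → d x ≠ 0 := fun x ha hb hxp =>
    hball (by rw [dist_eq, abs_lt]; constructor <;> linarith) hxp
  have hfc : ∀ x, c < x → ContinuousAt f x := fun x hx => (han x hx).continuousAt
  refine ⟨p, hx₀p, hfc p hcp, ε, hεp, Or.inr ⟨?_, ?_⟩⟩
  · refine strictConcaveOn_of_deriv2_neg (convex_Ioo _ _)
      (fun x hx => (hfc x (by linarith [hx.1])).continuousWithinAt) fun x hx => ?_
    rw [interior_Ioo] at hx
    change d x < 0
    by_contra! hx0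
    obtain ⟨q, hq1, hq2, hq3⟩ := hleft ε hεp
    have hpc : IsPreconnected (Ioo (p - ε) p) := isPreconnected_Ioo
    have hcd : ContinuousOn d (Ioo (p - ε) p) := fun y hy =>
      (hdan y (by linarith [hy.1])).continuousAt.continuousWithinAt
    obtain ⟨y, hy, hy0⟩ := hpc.intermediate_value (show q ∈ _ from ⟨hq1, hq2⟩) hx hcd
      (show (0 : ℝ) ∈ Icc (d q) (d x) from ⟨hq3.le, hx0⟩)
    exact hnz y hy.1 (by linarith [hy.2]) hy.2.ne hy0
  · refine strictConvexOn_of_deriv2_pos (convex_Ioo _ _)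
      (fun x hx => (hfc x (by linarith [hx.1])).continuousWithinAt) fun x hx => ?_
    rw [interior_Ioo] at hx
    change 0 < d x
    exact lt_of_le_of_ne (hright x hx.1 (by linarith [hx.2]))
      (hnz x (by linarith [hx.1]) hx.2 hx.1.ne').symm

lemma deriv_eq_zero_of_notMem_Icc {g : ℝ → ℝ} {a b : ℝ} (hg : ∀ y, y ∉ Icc a b → g y = 0)
    {y : ℝ} (hy : y ∉ Icc a b) : deriv g y = 0 := by
  have : g =ᶠ[𝓝 y] fun _ => 0 := by
    filter_upwards [isClosed_Icc.isOpen_compl.mem_nhds hy] with z hz using hg z hz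
  rw [this.deriv_eq]; simp

lemma integrable_of_continuousOn_Icc {g : ℝ → ℝ} {a b : ℝ} (hg : ContinuousOn g (Icc a b))
    (h0 : ∀ y, y ∉ Icc a b → g y = 0) : Integrable g := by
  have h1 : IntegrableOn g (Icc a b) := hg.integrableOn_compact isCompact_Icc
  refine (integrableOn_iff_integrable_of_support_subset fun y hy => ?_).1 h1
  by_contra h
  exact hy (h0 y h)

lemma tsupport_subset_Icc {g : ℝ → ℝ} {a b : ℝ} (h0 : ∀ y, y ∉ Icc a b → g y = 0) :
    tsupport g ⊆ Icc a b := by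
  refine closure_minimal (fun y hy => ?_) isClosed_Icc
  by_contra h
  exact hy (h0 y h)

lemma integral_deriv2_mul_nonneg {f ρ : ℝ → ℝ} {a b : ℝ} (hf : ∀ x ∈ Icc a b, AnalyticAt ℝ f x)
    (hf2 : ∀ x ∈ Icc a b, 0 ≤ deriv (deriv f) x) (hρ : ContDiff ℝ 2 ρ) (hρ0 : ∀ y, 0 ≤ ρ y)
    (hs : ∀ y, y ∉ Icc a b → ρ y = 0) : 0 ≤ ∫ x, f x * deriv (deriv ρ) x := by
  have hs1 : ∀ y, y ∉ Icc a b → deriv ρ y = 0 := fun y hy => deriv_eq_zero_of_notMem_Icc hs hy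
  have hs2 : ∀ y, y ∉ Icc a b → deriv (deriv ρ) y = 0 := fun y hy =>
    deriv_eq_zero_of_notMem_Icc hs1 hy
  have hρ1 : ContDiff ℝ 1 (deriv ρ) := ((contDiff_succ_iff_deriv (n := 1)).1 hρ).2.2
  have c0 : ContinuousOn ρ (Icc a b) := hρ.continuous.continuousOn
  have c1 : ContinuousOn (deriv ρ) (Icc a b) := hρ1.continuous.continuousOn
  have c2 : ContinuousOn (deriv (deriv ρ)) (Icc a b) :=
    (hρ1.continuous_deriv le_rfl).continuousOn
  have d0 : ContinuousOn f (Icc a b) := fun x hx => (hf x hx).continuousAt.continuousWithinAt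
  have d1 : ContinuousOn (deriv f) (Icc a b) := fun x hx =>
    (hf x hx).deriv.continuousAt.continuousWithinAt
  have d2 : ContinuousOn (deriv (deriv f)) (Icc a b) := fun x hx =>
    (hf x hx).deriv.deriv.continuousAt.continuousWithinAt
  have e1 : ∫ x, f x * deriv (deriv ρ) x = -∫ x, deriv f x * deriv ρ x := by
    refine integral_mul_deriv_eq_deriv_mul_of_integrable
      (fun x hx => (hf x (tsupport_subset_Icc hs1 hx)).differentiableAt.hasDerivAt)
      (fun x _ => (hρ1.differentiable one_ne_zero x).hasDerivAt) ?_ ?_ ?_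
    · exact integrable_of_continuousOn_Icc (d0.mul c2) fun y hy => by simp [hs2 y hy]
    · exact integrable_of_continuousOn_Icc (d1.mul c1) fun y hy => by simp [hs1 y hy]
    · exact integrable_of_continuousOn_Icc (d0.mul c1) fun y hy => by simp [hs1 y hy]
  have e2 : ∫ x, deriv f x * deriv ρ x = -∫ x, deriv (deriv f) x * ρ x := by
    refine integral_mul_deriv_eq_deriv_mul_of_integrable
      (fun x hx => (hf x (tsupport_subset_Icc hs hx)).deriv.differentiableAt.hasDerivAt)
      (fun x _ => (hρ.differentiable two_ne_zero x).hasDerivAt) ?_ ?_ ?_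
    · exact integrable_of_continuousOn_Icc (d1.mul c1) fun y hy => by simp [hs1 y hy]
    · exact integrable_of_continuousOn_Icc (d2.mul c0) fun y hy => by simp [hs y hy]
    · exact integrable_of_continuousOn_Icc (d1.mul c0) fun y hy => by simp [hs y hy]
  rw [e1, e2, neg_neg]
  refine integral_nonneg fun x => ?_
  by_cases hx : x ∈ Icc a b
  · exact mul_nonneg (hf2 x hx) (hρ0 x)
  · simp [hs x hx]

lemma IsPDF.integral_eq {P : Measure ℝ} {f : ℝ → ℝ} (hf : IsPDF P f) (g : ℝ → ℝ) :
    ∫ x, g x ∂P = ∫ x, f x * g x := by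
  obtain ⟨hm, h0, hP⟩ := hf
  rw [hP, integral_withDensity_eq_integral_toReal_smul₀]
  · refine integral_congr_ae (ae_of_all _ fun x => ?_)
    simp only [smul_eq_mul, ENNReal.toReal_ofReal (h0 x)]
  · exact hm.ennreal_ofReal.aemeasurable
  · exact ae_of_all _ fun x => ENNReal.ofReal_lt_top

lemma IsPDF.integrable {P : Measure ℝ} [IsFiniteMeasure P] {f : ℝ → ℝ} (hf : IsPDF P f) :
    Integrable f := by
  obtain ⟨hm, h0, hP⟩ := hf
  refine ⟨hm.aestronglyMeasurable, ?_⟩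
  rw [hasFiniteIntegral_iff_ofReal (ae_of_all _ h0)]
  have : ∫⁻ x, ENNReal.ofReal (f x) = P univ := by
    rw [hP, withDensity_apply _ MeasurableSet.univ]; simp
  rw [this]
  exact measure_lt_top _ _

/-- The density of a perturbed law is convex beyond `xHatUpper`, tested against a bump. -/
lemma integral_deriv2_perturbedLaw_nonneg {α β lam φ : ℝ} {n : ℕ} (hα : 0 < α) (hβ : 0 < β)
    {w : Fin n → ℝ} (hmem : MemQAbs lam φ α β w) (hw : ∃ i, 0 < w i) {j k : Fin n} (hjk : j ≠ k)
    {a b : ℝ} (hxa : xHatUpper lam φ α β < (a : EReal)) (hQa : -QMean α β w < a) {ρ : ℝ → ℝ}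
    (hρ : ContDiff ℝ 2 ρ) (hρ0 : ∀ y, 0 ≤ ρ y) (hs : ∀ y, y ∉ Icc a b → ρ y = 0) :
    0 ≤ ∫ y, deriv (deriv ρ) y ∂perturbedLaw α β w j k := by
  have := isProbabilityMeasure_perturbedLaw hα hβ w j k
  obtain ⟨f, hf, han⟩ := exists_pdf_perturbedLaw hα hβ hw j k
  rw [hf.integral_eq]
  refine integral_deriv2_mul_nonneg (fun x hx => han x (hQa.trans_le hx.1)) (fun x hx => ?_) hρ hρ0
    hs
  by_contra! hneg
  obtain ⟨p, hxp, hp⟩ := exists_inflectionPoint (hQa.trans_le hx.1) hf.2.1 hf.integrable han hneg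
  have h1 : (p : EReal) ≤ xHatUpper lam φ α β :=
    le_sSup ⟨n, w, j, k, p, hmem, hjk, ⟨f, hf, hp⟩, rfl⟩
  have h2 : (a : EReal) ≤ (p : EReal) := EReal.coe_le_coe_iff.2 (hx.1.trans hxp)
  exact absurd (hxa.trans_le (h2.trans h1)) (lt_irrefl _)

end Inflection

section Moments

variable {α β : ℝ} {n : ℕ}

/-- The centered linear form `∑ i, w i * (X i - c)`. -/
def centered (c : ℝ) {n : ℕ} (w X : Fin n → ℝ) : ℝ := ∑ i, w i * (X i - c)

@[fun_prop]
lemma continuous_centered (c : ℝ) (w : Fin n → ℝ) : Continuous fun X => centered c w X := by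
  unfold centered; fun_prop

lemma integrable_eval_pi (hα : 0 < α) (hβ : 0 < β) (i : Fin n) :
    Integrable (fun X : Fin n → ℝ => X i) (Measure.pi fun _ : Fin n => gammaMeasure α β) := by
  have := isProbabilityMeasure_gammaMeasure hα hβ
  exact (measurePreserving_eval (fun _ : Fin n => gammaMeasure α β) i).integrable_comp_of_integrable
    (integrable_id_gammaMeasure hα hβ)

lemma integral_eval_pi (hα : 0 < α) (hβ : 0 < β) (i : Fin n) :
    ∫ X, X i ∂(Measure.pi fun _ : Fin n => gammaMeasure α β) = α / β := by
  have := isProbabilityMeasure_gammaMeasure hα hβ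
  have hp := measurePreserving_eval (fun _ : Fin n => gammaMeasure α β) i
  have h := integral_map (f := fun x : ℝ => x) hp.aemeasurable (by fun_prop)
  rw [hp.map_eq, integral_id_gammaMeasure hα hβ] at h
  exact h.symm

lemma QMean_eq (hα : 0 < α) (hβ : 0 < β) (w : Fin n → ℝ) :
    QMean α β w = α / β * ∑ i, w i := by
  unfold QMean QLaw
  rw [integral_map (measurable_linearForm w).aemeasurable (by fun_prop), integral_finsetSum _
    fun i _ => (integrable_eval_pi hα hβ i).const_mul _]
  simp_rw [integral_const_mul, integral_eval_pi hα hβ]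
  rw [← Finset.sum_mul, mul_comm]

lemma linearForm_sub_QMean (hα : 0 < α) (hβ : 0 < β) (w X : Fin n → ℝ) :
    ∑ i, w i * X i - QMean α β w = centered (α / β) w X := by
  rw [QMean_eq hα hβ, centered, Finset.mul_sum, ← Finset.sum_sub_distrib]
  exact Finset.sum_congr rfl fun i _ => by ring

lemma variance_QLaw (hα : 0 < α) (hβ : 0 < β) (w : Fin n → ℝ) :
    variance (fun y : ℝ => y) (QLaw α β w) = α / β ^ 2 * ∑ i, w i ^ 2 := by
  have := isProbabilityMeasure_gammaMeasure hα hβ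
  unfold QLaw
  rw [variance_map (by fun_prop) (measurable_linearForm w).aemeasurable]
  have h := variance_sum_pi (μ := fun _ : Fin n => gammaMeasure α β)
    (X := fun i x => w i * x) fun i => (memLp_two_gammaMeasure hα hβ).const_mul (w i)
  have e : (fun y : ℝ => y) ∘ (fun X : Fin n → ℝ => ∑ i, w i * X i) =
      ∑ i, fun X : Fin n → ℝ => w i * X i := by
    ext X; simp
  rw [e, h, Finset.mul_sum]
  refine Finset.sum_congr rfl fun i _ => ?_
  rw [variance_const_mul, variance_gammaMeasure hα hβ, mul_comm]

lemma memLp_linearForm (hα : 0 < α) (hβ : 0 < β) (w : Fin n → ℝ) :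
    MemLp (fun X : Fin n → ℝ => ∑ i, w i * X i) 2
      (Measure.pi fun _ : Fin n => gammaMeasure α β) := by
  have := isProbabilityMeasure_gammaMeasure hα hβ
  refine memLp_finsetSum _ fun i _ => ?_
  exact ((memLp_two_gammaMeasure hα hβ).const_mul (w i)).comp_measurePreserving
    (measurePreserving_eval (fun _ : Fin n => gammaMeasure α β) i)

lemma memLp_centered (hα : 0 < α) (hβ : 0 < β) (w : Fin n → ℝ) :
    MemLp (fun X : Fin n → ℝ => centered (α / β) w X) 2
      (Measure.pi fun _ : Fin n => gammaMeasure α β) := by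
  have := isProbabilityMeasure_gammaMeasure hα hβ
  simp_rw [← linearForm_sub_QMean hα hβ]
  exact (memLp_linearForm hα hβ w).sub (memLp_const _)

lemma integral_centered_sq (hα : 0 < α) (hβ : 0 < β) (w : Fin n → ℝ) :
    ∫ X, centered (α / β) w X ^ 2 ∂(Measure.pi fun _ : Fin n => gammaMeasure α β) =
      α / β ^ 2 * ∑ i, w i ^ 2 := by
  have := isProbabilityMeasure_gammaMeasure hα hβ
  rw [← variance_QLaw hα hβ w, variance_eq_integral (by fun_prop)]
  change _ = ∫ y, (y - QMean α β w) ^ 2 ∂QLaw α β w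
  unfold QLaw
  rw [integral_map (measurable_linearForm w).aemeasurable (by fun_prop)]
  simp_rw [linearForm_sub_QMean hα hβ]

lemma sq_integral_abs_centered_le (hα : 0 < α) (hβ : 0 < β) (w : Fin n → ℝ) :
    (∫ X, |centered (α / β) w X| ∂(Measure.pi fun _ : Fin n => gammaMeasure α β)) ^ 2 ≤
      α / β ^ 2 * ∑ i, w i ^ 2 := by
  have := isProbabilityMeasure_gammaMeasure hα hβ
  have h := variance_nonneg (fun X : Fin n → ℝ => |centered (α / β) w X|)
    (Measure.pi fun _ : Fin n => gammaMeasure α β)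
  have hL : MemLp (fun X : Fin n → ℝ => |centered (α / β) w X|) 2
      (Measure.pi fun _ : Fin n => gammaMeasure α β) := (memLp_centered hα hβ w).abs
  rw [variance_eq_sub hL] at h
  rw [← integral_centered_sq hα hβ]
  have e : ∫ X, ((fun X : Fin n → ℝ => |centered (α / β) w X|) ^ 2) X
      ∂(Measure.pi fun _ : Fin n => gammaMeasure α β) =
      ∫ X, centered (α / β) w X ^ 2 ∂(Measure.pi fun _ : Fin n => gammaMeasure α β) := by
    simp
  rw [e] at h
  linarith

end Moments

section Expect

variable {α β : ℝ} {n : ℕ}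

/-- `E[h(Q_w - E[Q_w])]`. -/
noncomputable def expect (α β : ℝ) {n : ℕ} (h : ℝ → ℝ) (w : Fin n → ℝ) : ℝ :=
  ∫ y, h (y - QMean α β w) ∂QLaw α β w

lemma expect_eq (hα : 0 < α) (hβ : 0 < β) {h : ℝ → ℝ} (hh : Continuous h) (w : Fin n → ℝ) :
    expect α β h w =
      ∫ X, h (centered (α / β) w X) ∂(Measure.pi fun _ : Fin n => gammaMeasure α β) := by
  unfold expect QLaw
  rw [integral_map (measurable_linearForm w).aemeasurable (Continuous.aestronglyMeasurable (by fun_prop))]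
  simp_rw [linearForm_sub_QMean hα hβ]

lemma centered_sub (c : ℝ) (v w X : Fin n → ℝ) :
    centered c v X - centered c w X = centered c (v - w) X := by
  unfold centered
  rw [← Finset.sum_sub_distrib]
  exact Finset.sum_congr rfl fun i _ => by simp only [Pi.sub_apply]; ring

lemma abs_sub_le_of_deriv_bounded {h : ℝ → ℝ} (hh : Differentiable ℝ h) {C : ℝ}
    (hC : ∀ y, |deriv h y| ≤ C) (x y : ℝ) : |h x - h y| ≤ C * |x - y| := by
  simpa using convex_univ.norm_image_sub_le_of_norm_deriv_le (fun z _ => hh z)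
    (fun z _ => hC z) (mem_univ y) (mem_univ x)

/-- The expectation of a Lipschitz function is continuous in the weights for the Euclidean norm. -/
lemma abs_expect_sub_le (hα : 0 < α) (hβ : 0 < β) {h : ℝ → ℝ} (hh : Differentiable ℝ h) {C : ℝ}
    (hb : ∀ y, |h y| ≤ C) (hC : ∀ y, |deriv h y| ≤ C) (v w : Fin n → ℝ) :
    |expect α β h v - expect α β h w| ≤ C * √(α / β ^ 2 * ∑ i, (v i - w i) ^ 2) := by
  have := isProbabilityMeasure_gammaMeasure hα hβ
  have hC0 : 0 ≤ C := (abs_nonneg _).trans (hb 0)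
  have hi : ∀ u : Fin n → ℝ, Integrable (fun X => h (centered (α / β) u X))
      (Measure.pi fun _ : Fin n => gammaMeasure α β) := fun u =>
    Integrable.of_bound (hh.continuous.comp (continuous_centered _ _)).aestronglyMeasurable C
      (ae_of_all _ fun X => hb _)
  rw [expect_eq hα hβ hh.continuous, expect_eq hα hβ hh.continuous, ← integral_sub (hi v) (hi w)]
  have hint : Integrable (fun X => C * |centered (α / β) (v - w) X|)
      (Measure.pi fun _ : Fin n => gammaMeasure α β) :=
    ((memLp_centered hα hβ (v - w)).integrable one_le_two).abs.const_mul C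
  refine (abs_integral_le_integral_abs.trans (integral_mono ((hi v).sub (hi w)).abs hint
    fun X => ?_)).trans ?_
  · rw [← centered_sub]
    exact abs_sub_le_of_deriv_bounded hh hC _ _
  · rw [integral_const_mul]
    refine mul_le_mul_of_nonneg_left ?_ hC0
    exact le_sqrt_of_sq_le (sq_integral_abs_centered_le hα hβ (v - w))

lemma hasDerivAt_expect (hα : 0 < α) (hβ : 0 < β) {h : ℝ → ℝ} (hh : ContDiff ℝ 1 h) {C : ℝ}
    (hb : ∀ y, |h y| ≤ C) (hC : ∀ y, |deriv h y| ≤ C) {w : ℝ → Fin n → ℝ} {w' : Fin n → ℝ}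
    {t : ℝ} (hw : ∀ i, HasDerivAt (fun s => w s i) (w' i) t) :
    HasDerivAt (fun s => expect α β h (w s))
      (∑ j, w' j * ∫ X, (X j - α / β) * deriv h (centered (α / β) (w t) X)
        ∂(Measure.pi fun _ : Fin n => gammaMeasure α β)) t := by
  have := isProbabilityMeasure_gammaMeasure hα hβ
  set μ := Measure.pi fun _ : Fin n => gammaMeasure α β with hμ
  have hC0 : 0 ≤ C := (abs_nonneg _).trans (hb 0)
  have hhd : Differentiable ℝ h := hh.differentiable one_ne_zero
  have hdc : Continuous (deriv h) := hh.continuous_deriv le_rfl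
  let L : (Fin n → ℝ) → ((Fin n → ℝ) →L[ℝ] ℝ) := fun X =>
    ∑ i, (X i - α / β) • ContinuousLinearMap.proj (R := ℝ) (φ := fun _ : Fin n => ℝ) i
  have hLc : Continuous L := by fun_prop
  have hLapp : ∀ X v, L X v = centered (α / β) v X := fun X v => by
    simp [L, centered, mul_comm]
  have hLn : ∀ X, ‖L X‖ ≤ ∑ i, |X i - α / β| := fun X => by
    refine ContinuousLinearMap.opNorm_le_bound _ (Finset.sum_nonneg fun i _ => abs_nonneg _)
      fun v => ?_
    rw [hLapp, centered, Finset.sum_mul]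
    refine (Finset.abs_sum_le_sum_abs _ _).trans (Finset.sum_le_sum fun i _ => ?_)
    rw [abs_mul, mul_comm]
    exact mul_le_mul_of_nonneg_left (norm_le_pi_norm v i) (abs_nonneg _)
  have hi : ∀ i : Fin n, Integrable (fun X : Fin n → ℝ => X i - α / β) μ := fun i =>
    (integrable_eval_pi hα hβ i).sub (integrable_const _)
  have hbi : Integrable (fun X : Fin n → ℝ => C * ∑ i, |X i - α / β|) μ :=
    (integrable_finsetSum _ fun i _ => (hi i).abs).const_mul C
  have hbound : ∀ X v, ‖deriv h (centered (α / β) v X) • L X‖ ≤ C * ∑ i, |X i - α / β| := by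
    intro X v
    rw [norm_smul]
    exact mul_le_mul (hC _) (hLn X) (norm_nonneg _) hC0
  have hmeas : ∀ v, AEStronglyMeasurable (fun X => deriv h (centered (α / β) v X) • L X) μ :=
    fun v => ((hdc.comp (continuous_centered _ v)).smul hLc).aestronglyMeasurable
  have key := hasFDerivAt_integral_of_dominated_of_fderiv_le (𝕜 := ℝ) (μ := μ)
    (F := fun v X => h (centered (α / β) v X)) (x₀ := w t)
    (F' := fun v X => deriv h (centered (α / β) v X) • L X)
    (bound := fun X => C * ∑ i, |X i - α / β|) univ_mem
    (Eventually.of_forall fun v =>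
      (hhd.continuous.comp (continuous_centered _ v)).aestronglyMeasurable)
    (Integrable.of_bound (hhd.continuous.comp (continuous_centered _ _)).aestronglyMeasurable C
      (ae_of_all _ fun X => hb _))
    (hmeas _) (ae_of_all _ fun X v _ => hbound X v) hbi
    (ae_of_all _ fun X v _ => by
      have h1 : HasFDerivAt (fun v => centered (α / β) v X) (L X) v := by
        simp_rw [← hLapp]
        exact (L X).hasFDerivAt
      exact (hhd _).hasDerivAt.comp_hasFDerivAt v h1)
  have hpath : HasDerivAt w w' t := hasDerivAt_pi.2 hw
  have h2 := key.comp_hasDerivAt t hpath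
  have hF'i : Integrable (fun X => deriv h (centered (α / β) (w t) X) • L X) μ :=
    hbi.mono' (hmeas _) (ae_of_all _ fun X => hbound X _)
  rw [ContinuousLinearMap.integral_apply hF'i] at h2
  have e : ∀ s, expect α β h (w s) = ∫ X, h (centered (α / β) (w s) X) ∂μ := fun s =>
    expect_eq hα hβ hhd.continuous _
  simp_rw [e]
  refine h2.congr_deriv ?_
  simp only [smul_apply, hLapp, smul_eq_mul, centered, Finset.mul_sum]
  rw [integral_finsetSum]
  · refine Finset.sum_congr rfl fun i _ => ?_
    rw [← integral_const_mul]
    refine integral_congr_ae (ae_of_all _ fun X => ?_)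
    simp only; ring
  · intro i _
    have h3 : Integrable (fun X => (X i - α / β) * deriv h (centered (α / β) (w t) X)) μ :=
      (hi i).mul_bdd (c := C) (hdc.comp (continuous_centered _ _)).aestronglyMeasurable
        (ae_of_all _ fun X => hC _)
    refine (h3.const_mul (w' i)).congr (ae_of_all _ fun X => ?_)
    simp only [centered]; ring

end Expect

section Stein

variable {α β : ℝ} {n : ℕ}

lemma integral_pi_insertNth (hα : 0 < α) (hβ : 0 < β) (j : Fin (n + 1))
    {F : (Fin (n + 1) → ℝ) → ℝ}
    (hF : Integrable F (Measure.pi fun _ : Fin (n + 1) => gammaMeasure α β)) :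
    ∫ X, F X ∂(Measure.pi fun _ : Fin (n + 1) => gammaMeasure α β) =
      ∫ X, ∫ x, F (j.insertNth x X) ∂gammaMeasure α β
        ∂(Measure.pi fun _ : Fin n => gammaMeasure α β) := by
  have := isProbabilityMeasure_gammaMeasure hα hβ
  have h := (measurePreserving_piFinSuccAbove (fun _ : Fin (n + 1) => gammaMeasure α β) j).symm
  rw [← h.integral_comp', integral_prod_symm]
  · rfl
  · exact h.integrable_comp_of_integrable hF

lemma centered_insertNth (c : ℝ) (w : Fin (n + 1) → ℝ) (j : Fin (n + 1)) (x : ℝ) (X : Fin n → ℝ) :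
    centered c w (j.insertNth x X) =
      w j * (x - c) + centered c (fun i => w (j.succAbove i)) X := by
  unfold centered
  rw [Fin.sum_univ_succAbove _ j]
  simp

/-- Integrating the `j`-th centered coordinate by parts. -/
lemma integral_sub_mul_centered (hα : 0 < α) (hβ : 0 < β) {g : ℝ → ℝ} (hg : ContDiff ℝ 1 g) {C : ℝ}
    (hb : ∀ y, |g y| ≤ C) (hC : ∀ y, |deriv g y| ≤ C) (w : Fin n → ℝ) (j : Fin n) :
    ∫ X, (X j - α / β) * g (centered (α / β) w X)
        ∂(Measure.pi fun _ : Fin n => gammaMeasure α β) =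
      α / β ^ 2 * w j * ∫ X, ∫ y, deriv g (centered (α / β) w X + w j * y) ∂gammaMeasure 1 β
        ∂(Measure.pi fun _ : Fin n => gammaMeasure α β) := by
  have := isProbabilityMeasure_gammaMeasure hα hβ
  have := isProbabilityMeasure_gammaMeasure one_pos hβ
  have hα1 : 0 < α + 1 := by linarith
  have := isProbabilityMeasure_gammaMeasure hα1 hβ
  have hgc := hg.continuous
  have hdc : Continuous (deriv g) := hg.continuous_deriv le_rfl
  cases n with
  | zero => exact j.elim0
  | succ n =>
  rw [integral_pi_insertNth hα hβ j, integral_pi_insertNth hα hβ j, ← integral_const_mul]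
  · refine integral_congr_ae (ae_of_all _ fun X => ?_)
    simp only [centered_insertNth, Fin.insertNth_apply_same]
    set R := centered (α / β) (fun i => w (j.succAbove i)) X
    have hG : ∀ x, HasDerivAt (fun x => g (w j * (x - α / β) + R))
        (deriv g (w j * (x - α / β) + R) * (w j * 1)) x := fun x =>
      HasDerivAt.comp x ((hg.differentiable one_ne_zero _).hasDerivAt)
        ((((hasDerivAt_id x).sub_const _).const_mul _).add_const _)
    have hC0 : 0 ≤ C := (abs_nonneg _).trans (hb 0)
    rw [gamma_stein (C := max C (C * |w j|)) hα hβ hG (by fun_prop)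
      (fun x => (hb _).trans (le_max_left _ _)) (fun x => ?_)]
    · rw [integral_mul_const, mul_one, mul_comm _ (w j), ← mul_assoc]
      congr 1
      rw [← gammaMeasure_conv_one hα hβ, integral_conv]
      · refine integral_congr_ae (ae_of_all _ fun x => ?_)
        refine integral_congr_ae (ae_of_all _ fun y => ?_)
        simp only
        congr 1
        ring
      · exact Integrable.of_bound (Continuous.aestronglyMeasurable (by fun_prop)) C
          (ae_of_all _ fun x => hC _)
    · rw [mul_one, abs_mul]
      exact (mul_le_mul_of_nonneg_right (hC _) (abs_nonneg _)).trans (le_max_right _ _)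
  · refine Integrable.of_bound (C := C) ?_ (ae_of_all _ fun X => ?_)
    · have : Continuous fun q : (Fin (n + 1) → ℝ) × ℝ =>
          deriv g (centered (α / β) w q.1 + w j * q.2) :=
        hdc.comp (((continuous_centered _ w).comp continuous_fst).add
          (continuous_const.mul continuous_snd))
      exact this.aestronglyMeasurable.integral_prod_right'
    · refine (norm_integral_le_of_norm_le_const (ae_of_all _ fun y => hC _)).trans ?_
      simp
  · exact ((integrable_eval_pi hα hβ j).sub (integrable_const _)).mul_bdd (c := C)
      (hgc.comp (continuous_centered _ _)).aestronglyMeasurable (ae_of_all _ fun X => hb _)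

lemma integral_exp_shift {β : ℝ} (hβ : 0 < β) {g : ℝ → ℝ} (hg : ContDiff ℝ 1 g) {C : ℝ}
    (hb : ∀ y, |g y| ≤ C) (hC : ∀ y, |deriv g y| ≤ C) (c v : ℝ) :
    ∫ y, g (c + v * y) ∂gammaMeasure 1 β =
      g c + v / β * ∫ y, deriv g (c + v * y) ∂gammaMeasure 1 β := by
  have hC0 : 0 ≤ C := (abs_nonneg _).trans (hb 0)
  have hdc : Continuous (deriv g) := hg.continuous_deriv le_rfl
  have hG : ∀ x, HasDerivAt (fun x => g (c + v * x)) (deriv g (c + v * x) * (v * 1)) x := fun x =>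
    HasDerivAt.comp x ((hg.differentiable one_ne_zero _).hasDerivAt)
      (((hasDerivAt_id x).const_mul _).const_add _)
  rw [exp_stein (C := max C (C * |v|)) hβ hG (by fun_prop)
      (fun x => (hb _).trans (le_max_left _ _)) (fun x => ?_), integral_mul_const]
  · simp only [mul_zero, add_zero]
    ring
  · rw [mul_one, abs_mul]
    exact (mul_le_mul_of_nonneg_right (hC _) (abs_nonneg _)).trans (le_max_right _ _)

lemma integral_exp_sub_integral_exp {β : ℝ} (hβ : 0 < β) {g : ℝ → ℝ} (hg : ContDiff ℝ 1 g) {C : ℝ}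
    (hb : ∀ y, |g y| ≤ C) (hC : ∀ y, |deriv g y| ≤ C) (c v u : ℝ) :
    ∫ y, g (c + v * y) ∂gammaMeasure 1 β - ∫ y, g (c + u * y) ∂gammaMeasure 1 β =
      (v - u) / β * ∫ y, ∫ z, deriv g (c + v * y + u * z) ∂gammaMeasure 1 β
        ∂gammaMeasure 1 β := by
  have := isProbabilityMeasure_gammaMeasure one_pos hβ
  have hdc : Continuous (deriv g) := hg.continuous_deriv le_rfl
  have hgc := hg.continuous
  have h1 : ∀ v u : ℝ, ∫ y, ∫ z, g (c + v * y + u * z) ∂gammaMeasure 1 β ∂gammaMeasure 1 β =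
      ∫ y, g (c + v * y) ∂gammaMeasure 1 β +
        u / β * ∫ y, ∫ z, deriv g (c + v * y + u * z) ∂gammaMeasure 1 β ∂gammaMeasure 1 β := by
    intro v u
    simp_rw [integral_exp_shift hβ hg hb hC _ u]
    rw [integral_add, integral_const_mul]
    · exact Integrable.of_bound (Continuous.aestronglyMeasurable (by fun_prop)) C
        (ae_of_all _ fun x => hb _)
    · refine Integrable.const_mul ?_ _
      have : Continuous fun q : ℝ × ℝ => deriv g (c + v * q.1 + u * q.2) := by fun_prop
      refine Integrable.of_bound this.aestronglyMeasurable.integral_prod_right' C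
        (ae_of_all _ fun y => ?_)
      refine (norm_integral_le_of_norm_le_const (ae_of_all _ fun y => hC _)).trans ?_
      simp
  have h2 : ∀ f : ℝ → ℝ, Continuous f → (∀ y, |f y| ≤ C) →
      ∫ y, ∫ z, f (c + v * y + u * z) ∂gammaMeasure 1 β ∂gammaMeasure 1 β =
      ∫ y, ∫ z, f (c + u * y + v * z) ∂gammaMeasure 1 β ∂gammaMeasure 1 β := by
    intro f hf hfb
    rw [integral_integral_swap]
    · simp_rw [add_right_comm]
    · exact Integrable.of_bound (Continuous.aestronglyMeasurable (by fun_prop)) C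
        (ae_of_all _ fun x => hfb _)
  have e1 := h1 v u
  have e2 := h1 u v
  rw [← h2 g hgc hb, ← h2 _ hdc hC] at e2
  rw [e1] at e2
  field_simp
  field_simp at e2
  linarith

/-- `E[G(Q_w - E[Q_w] + w j * ψ)]`. -/
noncomputable def expectExp (α β : ℝ) {n : ℕ} (G : ℝ → ℝ) (w : Fin n → ℝ) (j : Fin n) : ℝ :=
  ∫ X, ∫ y, G (centered (α / β) w X + w j * y) ∂gammaMeasure 1 β
    ∂(Measure.pi fun _ : Fin n => gammaMeasure α β)

lemma integrable_expectExp (hα : 0 < α) (hβ : 0 < β) {G : ℝ → ℝ} (hG : Continuous G) {C : ℝ}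
    (hb : ∀ y, |G y| ≤ C) (w : Fin n → ℝ) (j : Fin n) :
    Integrable (fun X => ∫ y, G (centered (α / β) w X + w j * y) ∂gammaMeasure 1 β)
      (Measure.pi fun _ : Fin n => gammaMeasure α β) := by
  have := isProbabilityMeasure_gammaMeasure hα hβ
  have := isProbabilityMeasure_gammaMeasure one_pos hβ
  refine Integrable.of_bound (C := C) ?_ (ae_of_all _ fun X => ?_)
  · have : Continuous fun q : (Fin n → ℝ) × ℝ => G (centered (α / β) w q.1 + w j * q.2) :=
      hG.comp (((continuous_centered _ w).comp continuous_fst).add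
        (continuous_const.mul continuous_snd))
    exact this.aestronglyMeasurable.integral_prod_right'
  · refine (norm_integral_le_of_norm_le_const (ae_of_all _ fun y => hb _)).trans ?_
    simp

lemma integral_perturbedLaw (hα : 0 < α) (hβ : 0 < β) {G : ℝ → ℝ} (hG : Continuous G) {C : ℝ}
    (hb : ∀ y, |G y| ≤ C) (w : Fin n → ℝ) (j k : Fin n) :
    ∫ y, G y ∂perturbedLaw α β w j k =
      ∫ X, ∫ y, ∫ z, G (centered (α / β) w X + w j * y + w k * z) ∂gammaMeasure 1 β
        ∂gammaMeasure 1 β ∂(Measure.pi fun _ : Fin n => gammaMeasure α β) := by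
  have := isProbabilityMeasure_gammaMeasure hα hβ
  have := isProbabilityMeasure_gammaMeasure one_pos hβ
  unfold perturbedLaw
  have hc : Continuous fun p : (Fin n → ℝ) × ℝ × ℝ =>
      (∑ i, w i * p.1 i) + w j * p.2.1 + w k * p.2.2 - QMean α β w := by fun_prop
  rw [integral_map hc.aemeasurable hG.aestronglyMeasurable, integral_prod]
  · refine integral_congr_ae (ae_of_all _ fun X => ?_)
    simp only
    rw [integral_prod]
    · simp_rw [← linearForm_sub_QMean hα hβ]
      refine integral_congr_ae (ae_of_all _ fun y => ?_)
      refine integral_congr_ae (ae_of_all _ fun z => ?_)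
      simp only
      congr 1
      ring
    · exact Integrable.of_bound (Continuous.aestronglyMeasurable (by fun_prop)) C
        (ae_of_all _ fun x => hb _)
  · exact Integrable.of_bound (hG.comp hc).aestronglyMeasurable C (ae_of_all _ fun x => hb _)

lemma expectExp_sub (hα : 0 < α) (hβ : 0 < β) {g : ℝ → ℝ} (hg : ContDiff ℝ 1 g) {C : ℝ}
    (hb : ∀ y, |g y| ≤ C) (hC : ∀ y, |deriv g y| ≤ C) (w : Fin n → ℝ) (j k : Fin n) :
    expectExp α β g w j - expectExp α β g w k =
      (w j - w k) / β * ∫ y, deriv g y ∂perturbedLaw α β w j k := by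
  unfold expectExp
  rw [← integral_sub (integrable_expectExp hα hβ hg.continuous hb w j)
    (integrable_expectExp hα hβ hg.continuous hb w k),
    integral_perturbedLaw hα hβ (hg.continuous_deriv le_rfl) hC, ← integral_const_mul]
  refine integral_congr_ae (ae_of_all _ fun X => ?_)
  exact integral_exp_sub_integral_exp hβ hg hb hC _ _ _

end Stein

open scoped ContDiff

section TestFunction

/-- A bounded smooth nonincreasing function that is constant off `[a, b]`. -/
structure IsTestFunction (h : ℝ → ℝ) (a b : ℝ) : Prop where
  contDiff : ContDiff ℝ ∞ h
  bounded : ∃ C, ∀ y, |h y| ≤ C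
  deriv_nonpos : ∀ y, deriv h y ≤ 0
  deriv_eq_zero : ∀ y, y ∉ Icc a b → deriv h y = 0

lemma exists_bound_of_eq_zero_off_Icc {g : ℝ → ℝ} {a b : ℝ} (hg : Continuous g)
    (h0 : ∀ y, y ∉ Icc a b → g y = 0) : ∃ C, ∀ y, |g y| ≤ C := by
  obtain ⟨C, hC⟩ := isCompact_Icc.exists_bound_of_continuousOn (hg.continuousOn (s := Icc a b))
  refine ⟨max C 0, fun y => ?_⟩
  by_cases hy : y ∈ Icc a b
  · exact (hC y hy).trans (le_max_left _ _)
  · simp [h0 y hy]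

namespace IsTestFunction

variable {h : ℝ → ℝ} {a b : ℝ}

lemma contDiff_deriv (hh : IsTestFunction h a b) : ContDiff ℝ ∞ (deriv h) :=
  (contDiff_infty_iff_deriv.1 hh.contDiff).2

lemma contDiff_deriv2 (hh : IsTestFunction h a b) : ContDiff ℝ ∞ (deriv (deriv h)) :=
  (contDiff_infty_iff_deriv.1 hh.contDiff_deriv).2

lemma contDiff_deriv3 (hh : IsTestFunction h a b) : ContDiff ℝ ∞ (deriv (deriv (deriv h))) :=
  (contDiff_infty_iff_deriv.1 hh.contDiff_deriv2).2

lemma exists_bound (hh : IsTestFunction h a b) : ∃ C, ∀ y, |h y| ≤ C ∧ |deriv h y| ≤ C ∧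
    |deriv (deriv h) y| ≤ C ∧ |deriv (deriv (deriv h)) y| ≤ C := by
  have h1 := hh.deriv_eq_zero
  have h2 : ∀ y, y ∉ Icc a b → deriv (deriv h) y = 0 := fun y hy =>
    deriv_eq_zero_of_notMem_Icc h1 hy
  have h3 : ∀ y, y ∉ Icc a b → deriv (deriv (deriv h)) y = 0 := fun y hy =>
    deriv_eq_zero_of_notMem_Icc h2 hy
  obtain ⟨C0, hC0⟩ := hh.bounded
  obtain ⟨C1, hC1⟩ := exists_bound_of_eq_zero_off_Icc hh.contDiff_deriv.continuous h1
  obtain ⟨C2, hC2⟩ := exists_bound_of_eq_zero_off_Icc hh.contDiff_deriv2.continuous h2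
  obtain ⟨C3, hC3⟩ := exists_bound_of_eq_zero_off_Icc hh.contDiff_deriv3.continuous h3
  refine ⟨max (max C0 C1) (max C2 C3), fun y => ⟨?_, ?_, ?_, ?_⟩⟩
  · exact (hC0 y).trans ((le_max_left _ _).trans (le_max_left _ _))
  · exact (hC1 y).trans ((le_max_right _ _).trans (le_max_left _ _))
  · exact (hC2 y).trans ((le_max_left _ _).trans (le_max_right _ _))
  · exact (hC3 y).trans ((le_max_right _ _).trans (le_max_right _ _))

lemma neg_comp_neg (hh : IsTestFunction h a b) :
    IsTestFunction (fun y => -h (-y)) (-b) (-a) := by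
  have hd : ∀ y, deriv (fun y => -h (-y)) y = deriv h (-y) := fun y => by
    rw [deriv.fun_neg, deriv_comp_neg]; simp
  refine ⟨(hh.contDiff.comp contDiff_neg).neg, ?_, fun y => ?_, fun y hy => ?_⟩
  · obtain ⟨C, hC⟩ := hh.bounded
    exact ⟨C, fun y => by simpa using hC (-y)⟩
  · rw [hd]; exact hh.deriv_nonpos _
  · rw [hd]
    refine hh.deriv_eq_zero _ fun hm => hy ⟨by linarith [hm.2], by linarith [hm.1]⟩

end IsTestFunction

lemma isTestFunction_smoothTransition (x : ℝ) {δ : ℝ} (hδ : 0 < δ) :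
    IsTestFunction (fun y => 1 - smoothTransition ((y - x) / δ)) x (x + δ) := by
  have hanti : Antitone fun y => 1 - smoothTransition ((y - x) / δ) := fun y z hyz => by
    have := smoothTransition.monotone
      (show (y - x) / δ ≤ (z - x) / δ by gcongr)
    simp only
    linarith
  refine ⟨?_, ⟨1, fun y => ?_⟩, fun y => hanti.deriv_nonpos, fun y hy => ?_⟩
  · exact contDiff_const.sub (smoothTransition.contDiff.comp (by fun_prop))
  · have h1 := smoothTransition.nonneg ((y - x) / δ)
    have h2 := smoothTransition.le_one ((y - x) / δ)
    rw [abs_le]; constructor <;> linarith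
  · rw [mem_Icc, not_and_or, not_le, not_le] at hy
    rcases hy with hy | hy
    · have : (fun y => 1 - smoothTransition ((y - x) / δ)) =ᶠ[𝓝 y] fun _ => 1 := by
        filter_upwards [gt_mem_nhds hy] with z hz
        rw [smoothTransition.zero_of_nonpos (div_nonpos_of_nonpos_of_nonneg (by linarith) hδ.le),
          sub_zero]
      rw [this.deriv_eq]; simp
    · have : (fun y => 1 - smoothTransition ((y - x) / δ)) =ᶠ[𝓝 y] fun _ => 0 := by
        filter_upwards [lt_mem_nhds hy] with z hz
        rw [smoothTransition.one_of_one_le (by rw [le_div_iff₀ hδ]; linarith), sub_self]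
      rw [this.deriv_eq]; simp

end TestFunction

section Path

variable {α β lam φ : ℝ} {n : ℕ}

/-- The derivatives of `expect` with respect to the squared weights are ordered like the
weights. -/
lemma expectExp_deriv2_le (hα : 0 < α) (hβ : 0 < β) {w : Fin n → ℝ}
    (hmem : MemQAbs lam φ α β w) (hw : ∃ i, 0 < w i) {h : ℝ → ℝ} {a b : ℝ}
    (hh : IsTestFunction h a b) (hxa : xHatUpper lam φ α β < (a : EReal))
    (hQa : -QMean α β w < a) {j k : Fin n} (hjk : w k ≤ w j) :
    expectExp α β (deriv (deriv h)) w j ≤ expectExp α β (deriv (deriv h)) w k := by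
  rcases eq_or_ne j k with rfl | hne
  · exact le_rfl
  obtain ⟨C, hC⟩ := hh.exists_bound
  have h1 := expectExp_sub hα hβ (hh.contDiff_deriv2.of_le (by norm_cast))
    (fun y => (hC y).2.2.1) (fun y => (hC y).2.2.2) w j k
  have h2 := integral_deriv2_perturbedLaw_nonneg hα hβ hmem hw hne hxa hQa (b := b)
    (ρ := fun y => -deriv h y) (hh.contDiff_deriv.neg.of_le (by norm_cast))
    (fun y => neg_nonneg.2 (hh.deriv_nonpos y)) (fun y hy => by simp [hh.deriv_eq_zero y hy])
  have e : deriv (deriv fun y => -deriv h y) = fun y => -deriv (deriv (deriv h)) y := by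
    have : (deriv fun y => -deriv h y) = fun y => -deriv (deriv h) y := by
      ext y; rw [deriv.fun_neg]
    rw [this]; ext y; rw [deriv.fun_neg]
  rw [e, integral_neg] at h2
  have h3 : 0 ≤ (w j - w k) / β := div_nonneg (by linarith) hβ.le
  have := mul_nonneg h3 h2
  rw [mul_neg] at this
  linarith

lemma memQAbs_iff (hα : 0 < α) (hβ : 0 < β) (hlam : 0 < lam) (w : Fin n → ℝ) :
    MemQAbs lam φ α β w ↔ (∀ i, |w i| ≤ lam * β) ∧ α / β ^ 2 * ∑ i, w i ^ 2 = φ ^ 2 := by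
  unfold MemQAbs scale
  rw [variance_QLaw hα hβ, div_le_iff₀ hβ]
  refine and_congr_left fun _ => ⟨fun h i => ?_, fun h => ?_⟩
  · exact (le_ciSup (f := fun i => |w i|) (Set.finite_range _).bddAbove i).trans h
  · exact Real.iSup_le h (by positivity)

lemma mul_sum_le_sum_mul {K : ℕ} {b d : ℕ → ℝ} (hb : ∀ i j, i ≤ j → j < K → b j ≤ b i)
    (hd : ∀ k, k ≤ K → 0 ≤ ∑ i ∈ Finset.range k, d i) {c : ℝ} {k : ℕ} (hk : k ≤ K)
    (hc : ∀ i, i < k → c ≤ b i) :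
    c * ∑ i ∈ Finset.range k, d i ≤ ∑ i ∈ Finset.range k, d i * b i := by
  induction k generalizing c with
  | zero => simp
  | succ k ih =>
    have h1 := ih (c := b k) (by omega) fun i hi => hb i k hi.le hk
    have h2 := mul_le_mul_of_nonneg_right (hc k (by omega)) (hd (k + 1) hk)
    rw [Finset.sum_range_succ] at h2 ⊢
    rw [Finset.sum_range_succ]
    linarith

/-- Abel summation: an antitone nonnegative sequence against one with nonnegative partial sums. -/
lemma sum_mul_nonneg_of_partial_sums {K : ℕ} (b : Fin K → ℝ) (d : ℕ → ℝ) (hb : Antitone b)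
    (hb0 : ∀ i, 0 ≤ b i) (hd : ∀ k, k ≤ K → 0 ≤ ∑ i ∈ Finset.range k, d i) :
    0 ≤ ∑ i : Fin K, d i * b i := by
  let b' : ℕ → ℝ := fun i => if hi : i < K then b ⟨i, hi⟩ else 0
  have hb' : ∀ i : Fin K, b' i = b i := fun i => by simp [b']
  have h := mul_sum_le_sum_mul (b := b') (d := d) (K := K) (c := 0) (fun i j hij hj => by
    simp only [b', hj, hij.trans_lt hj, dif_pos]
    exact hb hij) hd le_rfl (fun i hi => by simp only [b', hi, dif_pos]; exact hb0 _)
  rw [zero_mul, Finset.sum_range] at h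
  simpa only [hb'] using h

lemma exists_hasDerivAt_sqrt {u v t : ℝ} (hu : 0 ≤ u) (hv : 0 ≤ v) (ht : t ∈ Ioo (0 : ℝ) 1) :
    ∃ d, HasDerivAt (fun t => √((1 - t) * u + t * v)) d t ∧
      √((1 - t) * u + t * v) * d = (v - u) / 2 := by
  have ht0 := ht.1
  have ht1 : 0 < 1 - t := by linarith [ht.2]
  rcases hu.eq_or_lt with rfl | hu'
  · rcases hv.eq_or_lt with rfl | hv'
    · exact ⟨0, by simpa using hasDerivAt_const t (0 : ℝ), by simp⟩
    · have h0 : 0 < (1 - t) * 0 + t * v := by positivity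
      refine ⟨_, HasDerivAt.sqrt ((((hasDerivAt_id t).const_sub 1).mul_const 0).add
        ((hasDerivAt_id t).mul_const v)) h0.ne', ?_⟩
      have := (sqrt_pos.2 h0).ne'
      field_simp
      ring
  · have h0 : 0 < (1 - t) * u + t * v := by positivity
    refine ⟨_, HasDerivAt.sqrt ((((hasDerivAt_id t).const_sub 1).mul_const u).add
        ((hasDerivAt_id t).mul_const v)) h0.ne', ?_⟩
    have := (sqrt_pos.2 h0).ne'
    field_simp
    ring

/-- The weights with squares `p 0, …, p (K - 1)` (positive weights) and `q 0, …, q (K - 1)`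
(negative weights), padded with `N` copies of `ε`. -/
noncomputable def weights (K N : ℕ) (p q : ℕ → ℝ) (ε : ℝ) : Fin (K + K + N) → ℝ :=
  Fin.append (Fin.append (fun i : Fin K => √(p i)) fun i : Fin K => -√(q i)) fun _ => ε

lemma sum_weights (K N : ℕ) (p q : ℕ → ℝ) (ε : ℝ) :
    ∑ i, weights K N p q ε i =
      ∑ i ∈ Finset.range K, √(p i) - ∑ i ∈ Finset.range K, √(q i) + N * ε := by
  simp [weights, Fin.sum_univ_add, Finset.sum_range, sub_eq_add_neg, -Fin.natAdd_eq_addNat]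

lemma sum_sq_weights (K N : ℕ) {p q : ℕ → ℝ} (hp : ∀ i, 0 ≤ p i) (hq : ∀ i, 0 ≤ q i) (ε : ℝ) :
    ∑ i, weights K N p q ε i ^ 2 =
      ∑ i ∈ Finset.range K, p i + ∑ i ∈ Finset.range K, q i + N * ε ^ 2 := by
  simp [weights, Fin.sum_univ_add, Finset.sum_range, sq_sqrt, hp, hq, -Fin.natAdd_eq_addNat]

lemma continuous_expect (hα : 0 < α) (hβ : 0 < β) {h : ℝ → ℝ} {a b : ℝ}
    (hh : IsTestFunction h a b) : Continuous fun w : Fin n → ℝ => expect α β h w := by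
  obtain ⟨C, hC⟩ := hh.exists_bound
  rw [continuous_iff_continuousAt]
  intro w
  rw [ContinuousAt, tendsto_iff_dist_tendsto_zero]
  have hc : Continuous fun v : Fin n → ℝ => C * √(α / β ^ 2 * ∑ i, (v i - w i) ^ 2) := by fun_prop
  have h0 := hc.tendsto w
  simp only [sub_self, ne_eq, OfNat.ofNat_ne_zero, not_false_eq_true, zero_pow,
    Finset.sum_const_zero, mul_zero, sqrt_zero] at h0
  exact squeeze_zero (fun _ => dist_nonneg) (fun v =>
    abs_expect_sub_le hα hβ (hh.contDiff.differentiable (by simp)) (fun y => (hC y).1)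
      (fun y => (hC y).2.1) v w) h0

/-- Moving the squared weights linearly in the direction of the order decreases `expect`. -/
lemma expect_weights_le (hα : 0 < α) (hβ : 0 < β) {h : ℝ → ℝ} {a b : ℝ}
    (hh : IsTestFunction h a b) (hxa : xHatUpper lam φ α β < (a : EReal)) {K N : ℕ} (hK : 0 < K)
    {p q p' q' : ℕ → ℝ} {ε : ℝ} (hp : ∀ i, 0 ≤ p i) (hq : ∀ i, 0 ≤ q i) (hp' : ∀ i, 0 ≤ p' i)
    (hq' : ∀ i, 0 ≤ q' i) (hpa : Antitone p) (hqa : Antitone q) (hpa' : Antitone p')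
    (hqa' : Antitone q') (hpp : ∀ k, ∑ i ∈ Finset.range k, p i ≤ ∑ i ∈ Finset.range k, p' i)
    (hqq : ∀ k, ∑ i ∈ Finset.range k, q' i ≤ ∑ i ∈ Finset.range k, q i)
    (hsum : ∑ i ∈ Finset.range K, p i + ∑ i ∈ Finset.range K, q i =
      ∑ i ∈ Finset.range K, p' i + ∑ i ∈ Finset.range K, q' i)
    (hgood : ∀ t ∈ Ioo (0 : ℝ) 1, ∀ w, w = weights K N (fun i => (1 - t) * p i + t * p' i)
      (fun i => (1 - t) * q i + t * q' i) ε →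
      MemQAbs lam φ α β w ∧ (∃ i, 0 < w i) ∧ -QMean α β w < a) :
    expect α β h (weights K N p' q' ε) ≤ expect α β h (weights K N p q ε) := by
  obtain ⟨C, hC⟩ := hh.exists_bound
  set W : ℝ → Fin (K + K + N) → ℝ := fun t => weights K N (fun i => (1 - t) * p i + t * p' i)
      (fun i => (1 - t) * q i + t * q' i) ε with hW
  have hWc : Continuous W := by
    refine continuous_pi fun i => ?_
    induction i using Fin.addCases with
    | left i =>
      induction i using Fin.addCases with
      | left i => simp only [W, weights, Fin.append_left]; fun_prop
      | right i => simp only [W, weights, Fin.append_left, Fin.append_right]; fun_prop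
    | right i => simp only [W, weights, Fin.append_right]; fun_prop
  have hderiv : ∀ t ∈ Ioo (0 : ℝ) 1, ∃ D, D ≤ 0 ∧
      HasDerivAt (fun s => expect α β h (W s)) D t := by
    intro t ht
    choose dp hdp hdp' using fun i => exists_hasDerivAt_sqrt (hp i) (hp' i) ht
    choose dq hdq hdq' using fun i => exists_hasDerivAt_sqrt (hq i) (hq' i) ht
    obtain ⟨hmem, hpos, hQ⟩ := hgood t ht (W t) rfl
    set A := fun j => expectExp α β (deriv (deriv h)) (W t) j with hA
    let W' : Fin (K + K + N) → ℝ :=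
      Fin.append (Fin.append (fun i : Fin K => dp i) fun i : Fin K => -dq i) fun _ => 0
    have hW' : ∀ i, HasDerivAt (fun s => W s i) (W' i) t := by
      intro i
      induction i using Fin.addCases with
      | left i =>
        induction i using Fin.addCases with
        | left i => simp only [W, W', weights, Fin.append_left]; exact hdp i
        | right i =>
          simp only [W, W', weights, Fin.append_left, Fin.append_right]; exact (hdq i).neg
      | right i => simp only [W, W', weights, Fin.append_right]; exact hasDerivAt_const _ _
    refine ⟨_, ?_, hasDerivAt_expect hα hβ (hh.contDiff.of_le (by norm_cast))
      (fun y => (hC y).1) (fun y => (hC y).2.1) hW'⟩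
    have e : ∀ j, W' j * ∫ X, (X j - α / β) * deriv h (centered (α / β) (W t) X)
        ∂(Measure.pi fun _ : Fin (K + K + N) => gammaMeasure α β) =
        α / β ^ 2 * (W t j * W' j * A j) := fun j => by
      rw [integral_sub_mul_centered hα hβ (hh.contDiff_deriv.of_le (by norm_cast))
        (fun y => (hC y).2.1) (fun y => (hC y).2.2.1)]
      simp only [hA, expectExp]
      ring
    simp_rw [e]
    rw [← Finset.mul_sum]
    refine mul_nonpos_of_nonneg_of_nonpos (by positivity) ?_
    let P : Fin K → Fin (K + K + N) := fun i => Fin.castAdd N (Fin.castAdd K i)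
    let R : Fin K → Fin (K + K + N) := fun i => Fin.castAdd N (Fin.natAdd K i)
    have hWP : ∀ i, W t (P i) = √((1 - t) * p i + t * p' i) := fun i => by
      simp [W, weights, P]
    have hWR : ∀ i, W t (R i) = -√((1 - t) * q i + t * q' i) := fun i => by
      simp [W, weights, R, -Fin.natAdd_eq_addNat]
    have hsumA : ∑ j, W t j * W' j * A j =
        ∑ i : Fin K, (p' i - p i) / 2 * A (P i) + ∑ i : Fin K, (q' i - q i) / 2 * A (R i) := by
      rw [Fin.sum_univ_add, Fin.sum_univ_add]
      have e1 : ∀ i : Fin K, W t (P i) * W' (P i) = (p' i - p i) / 2 := fun i => by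
        rw [hWP, ← hdp' i]; simp [W', P]
      have e2 : ∀ i : Fin K, W t (R i) * W' (R i) = (q' i - q i) / 2 := fun i => by
        rw [hWR, ← hdq' i]; simp [W', R, -Fin.natAdd_eq_addNat]
      have e3 : ∀ i : Fin N, W' (Fin.natAdd (K + K) i) = 0 := fun i => by simp [W']
      simp only [e3, mul_zero, zero_mul, Finset.sum_const_zero, add_zero]
      exact congrArg₂ _ (Finset.sum_congr rfl fun i _ => by rw [← e1])
        (Finset.sum_congr rfl fun i _ => by rw [← e2])
    have ht0 := ht.1.le
    have ht1 : 0 ≤ 1 - t := by linarith [ht.2]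
    have hAle : ∀ {j k}, W t k ≤ W t j → A j ≤ A k := fun hjk =>
      expectExp_deriv2_le hα hβ hmem hpos hh hxa hQ hjk
    set c := A (P ⟨K - 1, by omega⟩) with hc
    have hmonoP : Monotone fun i : Fin K => A (P i) := fun i j hij => hAle (by
      rw [hWP, hWP]
      have h1 := hpa (show (i : ℕ) ≤ j from hij)
      have h2 := hpa' (show (i : ℕ) ≤ j from hij)
      gcongr)
    have hantiR : Antitone fun i : Fin K => A (R i) := fun i j hij => hAle (by
      rw [hWR, hWR]
      have h1 := hqa (show (i : ℕ) ≤ j from hij)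
      have h2 := hqa' (show (i : ℕ) ≤ j from hij)
      gcongr)
    have hPc : ∀ i, A (P i) ≤ c := fun i => hmonoP (by
      rw [Fin.le_def]; have := i.2; simp only; omega)
    have hRc : ∀ i, c ≤ A (R i) := fun i => hAle (by
      rw [hWP, hWR]
      exact (neg_nonpos.2 (sqrt_nonneg _)).trans (sqrt_nonneg _))
    have s1 := sum_mul_nonneg_of_partial_sums (fun i : Fin K => c - A (P i))
      (fun i => (p' i - p i) / 2) (fun i j hij => by
        have := hmonoP hij
        simp only at this ⊢
        linarith) (fun i => by linarith [hPc i]) (fun k _ => by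
        rw [← Finset.sum_div, Finset.sum_sub_distrib]
        linarith [hpp k])
    have s2 := sum_mul_nonneg_of_partial_sums (fun i : Fin K => A (R i) - c)
      (fun i => (q i - q' i) / 2) (fun i j hij => by
        have := hantiR hij
        simp only at this ⊢
        linarith) (fun i => by linarith [hRc i]) (fun k _ => by
        rw [← Finset.sum_div, Finset.sum_sub_distrib]
        linarith [hqq k])
    have s3 : c * (∑ i : Fin K, (p' i - p i) / 2 + ∑ i : Fin K, (q' i - q i) / 2) = 0 := by
      rw [Finset.sum_range, Finset.sum_range, Finset.sum_range, Finset.sum_range] at hsum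
      rw [← Finset.sum_div, ← Finset.sum_div, Finset.sum_sub_distrib, Finset.sum_sub_distrib]
      have : ∑ i : Fin K, p' i - ∑ i : Fin K, p i + (∑ i : Fin K, q' i - ∑ i : Fin K, q i) = 0 := by
        linarith
      rw [← add_div, this]; simp
    rw [hsumA]
    have e4 : ∑ i : Fin K, (p' i - p i) / 2 * A (P i) + ∑ i : Fin K, (q' i - q i) / 2 * A (R i) =
        c * (∑ i : Fin K, (p' i - p i) / 2 + ∑ i : Fin K, (q' i - q i) / 2)
        - ∑ i : Fin K, (p' i - p i) / 2 * (c - A (P i))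
        - ∑ i : Fin K, (q i - q' i) / 2 * (A (R i) - c) := by
      rw [mul_add, Finset.mul_sum, Finset.mul_sum, ← Finset.sum_add_distrib,
        ← Finset.sum_add_distrib, ← Finset.sum_sub_distrib, ← Finset.sum_sub_distrib]
      exact Finset.sum_congr rfl fun i _ => by ring
    rw [e4, s3]
    linarith
  have hanti : AntitoneOn (fun s => expect α β h (W s)) (Icc 0 1) := by
    refine antitoneOn_of_deriv_nonpos (convex_Icc _ _)
      ((continuous_expect hα hβ hh).comp hWc).continuousOn (fun t ht => ?_) fun t ht => ?_
    · rw [interior_Icc] at ht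
      obtain ⟨D, _, hD⟩ := hderiv t ht
      exact hD.differentiableAt.differentiableWithinAt
    · rw [interior_Icc] at ht
      obtain ⟨D, hD0, hD⟩ := hderiv t ht
      rw [hD.deriv]; exact hD0
  have h1 := hanti (left_mem_Icc.2 zero_le_one) (right_mem_Icc.2 zero_le_one) zero_le_one
  simpa [W] using h1

end Path

section SortedDesc

@[to_additive]
lemma prod_range_getD {M : Type*} [CommMonoid M] {f : ℝ → M} (hf : f 0 = 1) (L : List ℝ) {K : ℕ}
    (hK : L.length ≤ K) : ∏ i ∈ Finset.range K, f (L.getD i 0) = (L.map f).prod := by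
  induction L generalizing K with
  | nil => simp [hf]
  | cons x L ih =>
    cases K with
    | zero => simp at hK
    | succ K =>
      rw [Finset.prod_range_succ']
      simp only [List.getD_cons_succ, List.getD_cons_zero, List.map_cons, List.prod_cons]
      rw [ih (by simpa using hK), mul_comm]

variable {n : ℕ}

@[to_additive]
lemma prod_range_sortedDesc {M : Type*} [CommMonoid M] {f : ℝ → M} (hf : f 0 = 1) (v : Fin n → ℝ)
    {K : ℕ} (hK : n ≤ K) : ∏ i ∈ Finset.range K, f (sortedDesc v i) = ∏ i, f (v i) := by
  unfold sortedDesc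
  rw [prod_range_getD hf _ (by simpa using hK),
    ((List.perm_insertionSort _ _).map f).prod_eq, List.map_ofFn, List.prod_ofFn]
  rfl

lemma sortedDesc_induction {Q : ℝ → Prop} {v : Fin n → ℝ} (h0 : Q 0) (hv : ∀ i, Q (v i)) (i : ℕ) :
    Q (sortedDesc v i) := by
  unfold sortedDesc
  rcases lt_or_ge i ((List.ofFn v).insertionSort (· ≥ ·)).length with h | h
  · rw [List.getD_eq_getElem _ _ h]
    have hm := List.getElem_mem h
    rw [(List.perm_insertionSort _ _).mem_iff, List.mem_ofFn] at hm
    obtain ⟨j, hj⟩ := hm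
    rw [← hj]
    exact hv j
  · rw [List.getD_eq_default _ _ h]
    exact h0

lemma antitone_sortedDesc {v : Fin n → ℝ} (hv : ∀ i, 0 ≤ v i) : Antitone (sortedDesc v) := by
  intro i j hij
  rcases hij.eq_or_lt with rfl | hlt
  · exact le_rfl
  rcases lt_or_ge j ((List.ofFn v).insertionSort (· ≥ ·)).length with h | h
  · unfold sortedDesc
    rw [List.getD_eq_getElem _ _ h, List.getD_eq_getElem _ _ (hlt.trans h)]
    exact List.pairwise_iff_getElem.1
      (List.pairwise_insertionSort (· ≥ ·) (List.ofFn v)) i j _ _ hlt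
  · have : sortedDesc v j = 0 := by
      unfold sortedDesc
      rw [List.getD_eq_default _ _ h]
    rw [this]
    exact sortedDesc_induction (Q := fun x => 0 ≤ x) le_rfl hv i

end SortedDesc

section Representation

variable {α β : ℝ} {n : ℕ}

lemma charFun_QLaw (hα : 0 < α) (hβ : 0 < β) (w : Fin n → ℝ) (t : ℝ) :
    charFun (QLaw α β w) t = ∏ i, charFun (gammaMeasure α β) (w i * t) := by
  have := isProbabilityMeasure_gammaMeasure hα hβ
  induction n with
  | zero => simp [QLaw_zero w hα hβ]
  | succ n ih =>
    have := isProbabilityMeasure_QLaw hα hβ fun j => w ((0 : Fin (n + 1)).succAbove j)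
    rw [QLaw_succAbove hα hβ w 0, charFun_conv, charFun_map_mul, ih,
      Fin.prod_univ_succAbove _ 0]

lemma QLaw_congr {m : ℕ} (hα : 0 < α) (hβ : 0 < β) {v : Fin m → ℝ} {w : Fin n → ℝ}
    (h : ∀ ψ : ℝ → ℂ, ψ 0 = 1 → ∏ i, ψ (v i) = ∏ i, ψ (w i)) : QLaw α β v = QLaw α β w := by
  have := isProbabilityMeasure_gammaMeasure hα hβ
  have := isProbabilityMeasure_QLaw hα hβ v
  have := isProbabilityMeasure_QLaw hα hβ w
  refine Measure.ext_of_charFun (funext fun t => ?_)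
  rw [charFun_QLaw hα hβ, charFun_QLaw hα hβ]
  exact h (fun x => charFun (gammaMeasure α β) (x * t)) (by simp)

lemma expect_congr {m : ℕ} {h : ℝ → ℝ} {v : Fin m → ℝ} {w : Fin n → ℝ}
    (hvw : QLaw α β v = QLaw α β w) : expect α β h v = expect α β h w := by
  unfold expect QMean
  rw [hvw]

/-- The squares of the positive parts, in decreasing order. -/
noncomputable def posSq (w : Fin n → ℝ) : ℕ → ℝ := sortedDesc fun i => (max (w i) 0) ^ 2

/-- The squares of the negative parts, in decreasing order. -/
noncomputable def negSq (w : Fin n → ℝ) : ℕ → ℝ := sortedDesc fun i => (min (w i) 0) ^ 2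

lemma posSq_nonneg (w : Fin n → ℝ) (i : ℕ) : 0 ≤ posSq w i :=
  sortedDesc_induction (Q := fun x => 0 ≤ x) le_rfl (fun _ => sq_nonneg _) i

lemma negSq_nonneg (w : Fin n → ℝ) (i : ℕ) : 0 ≤ negSq w i :=
  sortedDesc_induction (Q := fun x => 0 ≤ x) le_rfl (fun _ => sq_nonneg _) i

lemma posSq_le {w : Fin n → ℝ} {B : ℝ} (hB : ∀ i, |w i| ≤ B) (i : ℕ) : posSq w i ≤ B ^ 2 := by
  refine sortedDesc_induction (Q := fun x => x ≤ B ^ 2) (sq_nonneg _) (fun i => ?_) i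
  rw [sq_le_sq]
  refine le_trans ?_ ((hB i).trans (le_abs_self _))
  rcases le_total (w i) 0 with h | h <;> simp [h]

lemma negSq_le {w : Fin n → ℝ} {B : ℝ} (hB : ∀ i, |w i| ≤ B) (i : ℕ) : negSq w i ≤ B ^ 2 := by
  refine sortedDesc_induction (Q := fun x => x ≤ B ^ 2) (sq_nonneg _) (fun i => ?_) i
  rw [sq_le_sq]
  refine le_trans ?_ ((hB i).trans (le_abs_self _))
  rcases le_total (w i) 0 with h | h <;> simp [h]

lemma sum_posSq_add_sum_negSq (w : Fin n → ℝ) {K : ℕ} (hK : n ≤ K) :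
    ∑ i ∈ Finset.range K, posSq w i + ∑ i ∈ Finset.range K, negSq w i = ∑ i, w i ^ 2 := by
  have h1 := sum_range_sortedDesc (f := fun x : ℝ => x) rfl (fun i => (max (w i) 0) ^ 2) hK
  have h2 := sum_range_sortedDesc (f := fun x : ℝ => x) rfl (fun i => (min (w i) 0) ^ 2) hK
  unfold posSq negSq
  rw [h1, h2, ← Finset.sum_add_distrib]
  refine Finset.sum_congr rfl fun i _ => ?_
  rcases le_total (w i) 0 with h | h <;> simp [h]

lemma QLaw_weights (hα : 0 < α) (hβ : 0 < β) (w : Fin n → ℝ) {K : ℕ} (hK : n ≤ K) (N : ℕ) :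
    QLaw α β (weights K N (posSq w) (negSq w) 0) = QLaw α β w := by
  refine QLaw_congr hα hβ fun ψ hψ => ?_
  have h1 := prod_range_sortedDesc (f := fun x : ℝ => ψ (√x)) (by simpa using hψ)
    (fun i => (max (w i) 0) ^ 2) hK
  have h2 := prod_range_sortedDesc (f := fun x : ℝ => ψ (-√x)) (by simpa using hψ)
    (fun i => (min (w i) 0) ^ 2) hK
  have h3 : ∏ i, ψ (weights K N (posSq w) (negSq w) 0 i) =
      (∏ i ∈ Finset.range K, ψ (√(posSq w i))) * ∏ i ∈ Finset.range K, ψ (-√(negSq w i)) := by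
    simp [weights, Fin.prod_univ_add, Finset.prod_range, hψ, -Fin.natAdd_eq_addNat]
  rw [h3]
  unfold posSq negSq
  rw [h1, h2, ← Finset.prod_mul_distrib]
  refine Finset.prod_congr rfl fun i _ => ?_
  rw [sqrt_sq (le_max_right _ _), sqrt_sq_eq_abs, abs_of_nonpos (min_le_right _ _), neg_neg]
  rcases le_total (w i) 0 with h | h <;> simp [h, hψ]

lemma abs_expect_weights_sub_le (hα : 0 < α) (hβ : 0 < β) {h : ℝ → ℝ} (hh : Differentiable ℝ h)
    {C : ℝ} (hb : ∀ y, |h y| ≤ C) (hC : ∀ y, |deriv h y| ≤ C) (K N : ℕ) {p q : ℕ → ℝ}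
    (hp : ∀ i, 0 ≤ p i) (hq : ∀ i, 0 ≤ q i) (ε : ℝ) {η : ℝ} (hη : η ∈ Icc (0 : ℝ) 1) :
    |expect α β h (weights K N p q 0) -
        expect α β h (weights K N (fun i => (1 - η) * p i) (fun i => (1 - η) * q i) ε)| ≤
      C * √(α / β ^ 2 * (η * (∑ i ∈ Finset.range K, p i + ∑ i ∈ Finset.range K, q i) +
        N * ε ^ 2)) := by
  have hC0 : 0 ≤ C := (abs_nonneg _).trans (hb 0)
  refine (abs_expect_sub_le hα hβ hh hb hC _ _).trans ?_
  have key : ∀ x, 0 ≤ x → (√x - √((1 - η) * x)) ^ 2 ≤ η * x := by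
    intro x hx
    have h1 : 0 ≤ 1 - η := by linarith [hη.2]
    rw [sqrt_mul h1]
    have e1 := sq_sqrt h1
    have e2 := sq_sqrt hx
    have r0 := sqrt_nonneg (1 - η)
    have r1 : √(1 - η) ≤ 1 := sqrt_le_iff.2 ⟨zero_le_one, by linarith [hη.1]⟩
    have : (√x - √(1 - η) * √x) ^ 2 = (1 - √(1 - η)) ^ 2 * x := by
      rw [← e2]; simp only [sqrt_sq (sqrt_nonneg x)]; ring
    rw [this]
    refine mul_le_mul_of_nonneg_right ?_ hx
    nlinarith
  gcongr
  have e : ∑ i, (weights K N p q 0 i -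
      weights K N (fun i => (1 - η) * p i) (fun i => (1 - η) * q i) ε i) ^ 2 =
      ∑ i ∈ Finset.range K, (√(p i) - √((1 - η) * p i)) ^ 2 +
      ∑ i ∈ Finset.range K, (√(q i) - √((1 - η) * q i)) ^ 2 + N * ε ^ 2 := by
    simp only [weights, Fin.sum_univ_add, Finset.sum_range, Fin.append_left, Fin.append_right]
    congr 1
    · congr 1
      exact Finset.sum_congr rfl fun i _ => by ring
    · simp
  rw [e, mul_add, Finset.mul_sum, Finset.mul_sum]
  gcongr
  · exact key _ (hp _)
  · exact key _ (hq _)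

end Representation

section Main

variable {α β lam φ : ℝ} {m n : ℕ}

lemma abs_weights_le {K N : ℕ} {p q : ℕ → ℝ} {ε B : ℝ} (hB : 0 ≤ B) (hp : ∀ i, p i ≤ B ^ 2)
    (hq : ∀ i, q i ≤ B ^ 2) (hε : |ε| ≤ B) (i : Fin (K + K + N)) :
    |weights K N p q ε i| ≤ B := by
  induction i using Fin.addCases with
  | left i =>
    induction i using Fin.addCases with
    | left i =>
      simp only [weights, Fin.append_left, abs_of_nonneg (sqrt_nonneg _)]
      exact sqrt_le_iff.2 ⟨hB, hp i⟩
    | right i =>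
      simp only [weights, Fin.append_left, Fin.append_right, abs_neg, abs_of_nonneg (sqrt_nonneg _)]
      exact sqrt_le_iff.2 ⟨hB, hq i⟩
  | right i => simpa only [weights, Fin.append_right] using hε

/-- The comparison of `expect`, with a fraction `η` of the variance moved to tiny positive
weights. -/
lemma expect_padded_le (hα : 0 < α) (hβ : 0 < β) (hlam : 0 < lam) {h : ℝ → ℝ} {a b : ℝ}
    (hh : IsTestFunction h a b) (hxa : xHatUpper lam φ α β < (a : EReal)) {K : ℕ} (hK : 0 < K)
    {p q p' q' : ℕ → ℝ} (hp : ∀ i, 0 ≤ p i) (hq : ∀ i, 0 ≤ q i) (hp' : ∀ i, 0 ≤ p' i)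
    (hq' : ∀ i, 0 ≤ q' i) (hpa : Antitone p) (hqa : Antitone q) (hpa' : Antitone p')
    (hqa' : Antitone q') (hpB : ∀ i, p i ≤ (lam * β) ^ 2) (hqB : ∀ i, q i ≤ (lam * β) ^ 2)
    (hpB' : ∀ i, p' i ≤ (lam * β) ^ 2) (hqB' : ∀ i, q' i ≤ (lam * β) ^ 2)
    (hpp : ∀ k, ∑ i ∈ Finset.range k, p i ≤ ∑ i ∈ Finset.range k, p' i)
    (hqq : ∀ k, ∑ i ∈ Finset.range k, q' i ≤ ∑ i ∈ Finset.range k, q i) {S : ℝ} (hS : 0 < S)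
    (hSφ : α / β ^ 2 * S = φ ^ 2)
    (hsum : ∑ i ∈ Finset.range K, p i + ∑ i ∈ Finset.range K, q i = S)
    (hsum' : ∑ i ∈ Finset.range K, p' i + ∑ i ∈ Finset.range K, q' i = S)
    {η : ℝ} (hη : η ∈ Ioo (0 : ℝ) 1) :
    ∃ (N : ℕ) (ε : ℝ), N * ε ^ 2 = η * S ∧
      expect α β h (weights K N (fun i => (1 - η) * p' i) (fun i => (1 - η) * q' i) ε) ≤
      expect α β h (weights K N (fun i => (1 - η) * p i) (fun i => (1 - η) * q i) ε) := by
  set B := lam * β with hB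
  have hB0 : 0 < B := by positivity
  have hη0 := hη.1
  have hη1 : 0 < 1 - η := by linarith [hη.2]
  have hηS : 0 < η * S := by positivity
  set R := K * B + |a| * β / α with hR
  have hR0 : 0 ≤ R := by positivity
  obtain ⟨N, hN⟩ := exists_nat_gt (max (R ^ 2 / (η * S)) (η * S / B ^ 2))
  have hN1 : R ^ 2 / (η * S) < N := (le_max_left _ _).trans_lt hN
  have hN2 : η * S / B ^ 2 < N := (le_max_right _ _).trans_lt hN
  have hN0 : (0 : ℝ) < N := lt_of_le_of_lt (by positivity) hN1
  set ε := √(η * S / N) with hε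
  have hε0 : 0 < ε := sqrt_pos.2 (by positivity)
  have hε2 : N * ε ^ 2 = η * S := by
    rw [hε, sq_sqrt (by positivity)]; field_simp
  have hεB : |ε| ≤ B := by
    rw [abs_of_pos hε0]
    refine sqrt_le_iff.2 ⟨hB0.le, ?_⟩
    rw [div_le_iff₀ hN0]
    rw [div_lt_iff₀ (by positivity)] at hN2
    linarith
  have hNε : R < N * ε := by
    refine lt_of_pow_lt_pow_left₀ 2 (by positivity) ?_
    rw [div_lt_iff₀ hηS, ← hε2] at hN1
    calc R ^ 2 < N * (N * ε ^ 2) := hN1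
      _ = _ := by ring
  refine ⟨N, ε, hε2, ?_⟩
  refine expect_weights_le hα hβ hh hxa hK (fun i => mul_nonneg hη1.le (hp i))
    (fun i => mul_nonneg hη1.le (hq i)) (fun i => mul_nonneg hη1.le (hp' i))
    (fun i => mul_nonneg hη1.le (hq' i)) (hpa.const_mul hη1.le) (hqa.const_mul hη1.le)
    (hpa'.const_mul hη1.le) (hqa'.const_mul hη1.le) (fun k => ?_) (fun k => ?_) ?_ ?_
  · rw [← Finset.mul_sum, ← Finset.mul_sum]
    exact mul_le_mul_of_nonneg_left (hpp k) hη1.le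
  · rw [← Finset.mul_sum, ← Finset.mul_sum]
    exact mul_le_mul_of_nonneg_left (hqq k) hη1.le
  · simp_rw [← Finset.mul_sum]
    rw [← mul_add, ← mul_add, hsum, hsum']
  · rintro t ht w rfl
    have ht0 := ht.1.le
    have ht1 : 0 ≤ 1 - t := by linarith [ht.2]
    have hB2 : 0 ≤ B ^ 2 := by positivity
    have hmix0 : ∀ u v : ℝ, 0 ≤ u → 0 ≤ v → 0 ≤ (1 - t) * ((1 - η) * u) + t * ((1 - η) * v) :=
      fun u v hu hv => by positivity
    have hmixB : ∀ u v : ℝ, u ≤ B ^ 2 → v ≤ B ^ 2 →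
        (1 - t) * ((1 - η) * u) + t * ((1 - η) * v) ≤ B ^ 2 := fun u v hu hv => by
      have h1 : (1 - η) * u ≤ B ^ 2 := by nlinarith
      have h2 : (1 - η) * v ≤ B ^ 2 := by nlinarith
      nlinarith
    refine ⟨?_, ?_, ?_⟩
    · rw [memQAbs_iff hα hβ hlam]
      refine ⟨fun i => abs_weights_le hB0.le (fun i => hmixB _ _ (hpB i) (hpB' i))
        (fun i => hmixB _ _ (hqB i) (hqB' i)) hεB i, ?_⟩
      rw [sum_sq_weights K N (fun i => hmix0 _ _ (hp i) (hp' i))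
        (fun i => hmix0 _ _ (hq i) (hq' i)), hε2, ← hSφ]
      simp_rw [Finset.sum_add_distrib, ← Finset.mul_sum]
      congr 1
      linear_combination (1 - t) * (1 - η) * hsum + t * (1 - η) * hsum'
    · have hNn : 0 < N := by exact_mod_cast hN0
      exact ⟨Fin.natAdd (K + K) ⟨0, hNn⟩, by simpa only [weights, Fin.append_right] using hε0⟩
    · rw [QMean_eq hα hβ, sum_weights]
      have h1 : 0 ≤ ∑ i ∈ Finset.range K, √((1 - t) * ((1 - η) * p i) + t * ((1 - η) * p' i)) :=
        Finset.sum_nonneg fun i _ => sqrt_nonneg _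
      have h2 : ∑ i ∈ Finset.range K, √((1 - t) * ((1 - η) * q i) + t * ((1 - η) * q' i)) ≤
          K * B := by
        refine (Finset.sum_le_card_nsmul _ _ B fun i _ => ?_).trans (by simp)
        exact sqrt_le_iff.2 ⟨hB0.le, hmixB _ _ (hqB i) (hqB' i)⟩
      have h3 : |a| * β / α < ∑ i ∈ Finset.range K,
          √((1 - t) * ((1 - η) * p i) + t * ((1 - η) * p' i)) - ∑ i ∈ Finset.range K,
          √((1 - t) * ((1 - η) * q i) + t * ((1 - η) * q' i)) + N * ε := by linarith
      have h4 := mul_lt_mul_of_pos_left h3 (show 0 < α / β by positivity)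
      have h5 : α / β * (|a| * β / α) = |a| := by field_simp
      rw [h5] at h4
      linarith [neg_abs_le a]

/-- The comparison of the laws, tested against functions supported beyond `xHatUpper`. -/
lemma expect_le_of_frobMaj (hα : 0 < α) (hβ : 0 < β) (hlam : 0 < lam) (hφ : 0 < φ)
    {μ : Fin m → ℝ} {l : Fin n → ℝ} (hμ : MemQAbs lam φ α β μ) (hl : MemQAbs lam φ α β l)
    (hmaj : FrobMaj μ l) {h : ℝ → ℝ} {a b : ℝ} (hh : IsTestFunction h a b)
    (hxa : xHatUpper lam φ α β < (a : EReal)) : expect α β h l ≤ expect α β h μ := by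
  obtain ⟨C, hC⟩ := hh.exists_bound
  have hC0 : 0 ≤ C := (abs_nonneg _).trans (hC 0).1
  rw [memQAbs_iff hα hβ hlam] at hμ hl
  set K := max m n + 1 with hK
  have hKm : m ≤ K := by omega
  have hKn : n ≤ K := by omega
  set S := ∑ i, l i ^ 2 with hS
  have hSpos : 0 < S := by
    have h1 : 0 < α / β ^ 2 * S := by rw [hl.2]; positivity
    exact pos_of_mul_pos_right h1 (by positivity)
  have hsum := (sum_posSq_add_sum_negSq μ hKm).trans hmaj.2.2
  have hsum' := sum_posSq_add_sum_negSq l hKn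
  have hbound : ∀ η ∈ Ioo (0 : ℝ) 1,
      expect α β h l ≤ expect α β h μ + 2 * (C * √(2 * φ ^ 2 * η)) := by
    intro η hη
    obtain ⟨N, ε, hε, hle⟩ := expect_padded_le hα hβ hlam hh hxa (K := K) (by omega)
      (posSq_nonneg μ) (negSq_nonneg μ) (posSq_nonneg l) (negSq_nonneg l)
      (antitone_sortedDesc fun _ => sq_nonneg _) (antitone_sortedDesc fun _ => sq_nonneg _)
      (antitone_sortedDesc fun _ => sq_nonneg _) (antitone_sortedDesc fun _ => sq_nonneg _)
      (posSq_le hμ.1) (negSq_le hμ.1) (posSq_le hl.1) (negSq_le hl.1) hmaj.1 hmaj.2.1 hSpos hl.2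
      hsum hsum' hη
    have hd : Differentiable ℝ h := hh.contDiff.differentiable (by simp)
    have hηI : η ∈ Icc (0 : ℝ) 1 := Ioo_subset_Icc_self hη
    have e1 := abs_expect_weights_sub_le hα hβ hd (fun y => (hC y).1) (fun y => (hC y).2.1) K N
      (posSq_nonneg μ) (negSq_nonneg μ) ε hηI
    have e2 := abs_expect_weights_sub_le hα hβ hd (fun y => (hC y).1) (fun y => (hC y).2.1) K N
      (posSq_nonneg l) (negSq_nonneg l) ε hηI
    have e3 : α / β ^ 2 * (η * S + η * S) = 2 * φ ^ 2 * η := by rw [← hl.2]; ring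
    rw [hsum, hε, e3, expect_congr (QLaw_weights hα hβ μ hKm N)] at e1
    rw [hsum', hε, e3, expect_congr (QLaw_weights hα hβ l hKn N)] at e2
    linarith [(abs_le.1 e1).1, (abs_le.1 e2).2]
  have hc : Continuous fun η : ℝ => expect α β h μ + 2 * (C * √(2 * φ ^ 2 * η)) := by fun_prop
  have hlim := (hc.tendsto 0).mono_left (nhdsWithin_le_nhds (s := Ioi 0))
  simp only [mul_zero, sqrt_zero, add_zero] at hlim
  refine ge_of_tendsto hlim ?_
  filter_upwards [Ioo_mem_nhdsGT zero_lt_one] with η hη using hbound η hη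

lemma memQAbs_neg (hα : 0 < α) (hβ : 0 < β) (hlam : 0 < lam) {w : Fin n → ℝ}
    (hw : MemQAbs lam φ α β w) : MemQAbs lam φ α β (-w) := by
  rw [memQAbs_iff hα hβ hlam] at hw ⊢
  simpa using hw

lemma FrobMaj.neg {μ : Fin m → ℝ} {l : Fin n → ℝ} (h : FrobMaj μ l) : FrobMaj (-l) (-μ) := by
  have h1 : ∀ x : ℝ, max (-x) 0 ^ 2 = min x 0 ^ 2 := fun x => by
    rcases le_total x 0 with hx | hx <;> simp [hx]
  have h2 : ∀ x : ℝ, min (-x) 0 ^ 2 = max x 0 ^ 2 := fun x => by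
    rcases le_total x 0 with hx | hx <;> simp [hx]
  refine ⟨?_, ?_, ?_⟩
  · simpa only [Pi.neg_apply, h1] using h.2.1
  · simpa only [Pi.neg_apply, h2] using h.1
  · simpa using h.2.2.symm

lemma expect_neg (hα : 0 < α) (hβ : 0 < β) {h : ℝ → ℝ} (hh : Continuous h) (w : Fin n → ℝ) :
    expect α β (fun y => -h (-y)) (-w) = -expect α β h w := by
  rw [expect_eq hα hβ (by fun_prop), expect_eq hα hβ hh, ← integral_neg]
  refine integral_congr_ae (ae_of_all _ fun X => ?_)
  simp [centered]

lemma centeredCDF_eq_cdf (hα : 0 < α) (hβ : 0 < β) (w : Fin n → ℝ) (x : ℝ) :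
    centeredCDF α β w x = cdf (QLaw α β w) (x + QMean α β w) := by
  have := isProbabilityMeasure_QLaw hα hβ w
  rw [cdf_eq_real, centeredCDF]
  congr 1
  ext y
  simp

lemma centeredCDF_eq_integral (w : Fin n → ℝ) (x : ℝ) :
    centeredCDF α β w x =
      ∫ y, {y | y - QMean α β w ≤ x}.indicator (fun _ => (1 : ℝ)) y ∂QLaw α β w := by
  have hm : MeasurableSet {y | y - QMean α β w ≤ x} :=
    measurableSet_le (by fun_prop) measurable_const
  rw [integral_indicator hm]
  simp [centeredCDF]

lemma centeredCDF_le_expect (hα : 0 < α) (hβ : 0 < β) (w : Fin n → ℝ) (x : ℝ) {h : ℝ → ℝ}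
    (hh : Continuous h) (h0 : ∀ y, 0 ≤ h y) (h1 : ∀ y, h y ≤ 1) (hx : ∀ y, y ≤ x → h y = 1) :
    centeredCDF α β w x ≤ expect α β h w := by
  have := isProbabilityMeasure_QLaw hα hβ w
  have hm : MeasurableSet {y | y - QMean α β w ≤ x} :=
    measurableSet_le (by fun_prop) measurable_const
  rw [centeredCDF_eq_integral]
  refine integral_mono ((integrable_const _).indicator hm) (Integrable.of_bound
    (Continuous.aestronglyMeasurable (by fun_prop)) 1 (ae_of_all _ fun y => ?_)) fun y => ?_
  · rw [norm_eq_abs, abs_of_nonneg (h0 _)]; exact h1 _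
  · by_cases hy : y - QMean α β w ≤ x
    · rw [indicator_of_mem (show y ∈ {y | y - QMean α β w ≤ x} from hy)]
      exact (hx _ hy).ge
    · rw [indicator_of_notMem (show y ∉ {y | y - QMean α β w ≤ x} from hy)]
      exact h0 _

lemma expect_le_centeredCDF (hα : 0 < α) (hβ : 0 < β) (w : Fin n → ℝ) (x : ℝ) {h : ℝ → ℝ}
    (hh : Continuous h) (h0 : ∀ y, 0 ≤ h y) (h1 : ∀ y, h y ≤ 1) (hx : ∀ y, x < y → h y = 0) :
    expect α β h w ≤ centeredCDF α β w x := by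
  have := isProbabilityMeasure_QLaw hα hβ w
  have hm : MeasurableSet {y | y - QMean α β w ≤ x} :=
    measurableSet_le (by fun_prop) measurable_const
  rw [centeredCDF_eq_integral]
  refine integral_mono (Integrable.of_bound
    (Continuous.aestronglyMeasurable (by fun_prop)) 1 (ae_of_all _ fun y => ?_))
    ((integrable_const _).indicator hm) fun y => ?_
  · rw [norm_eq_abs, abs_of_nonneg (h0 _)]; exact h1 _
  · by_cases hy : y - QMean α β w ≤ x
    · rw [indicator_of_mem (show y ∈ {y | y - QMean α β w ≤ x} from hy)]
      exact h1 _
    · rw [indicator_of_notMem (show y ∉ {y | y - QMean α β w ≤ x} from hy)]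
      exact (hx _ (not_le.1 hy)).le

lemma exists_expect_smoothTransition_le (hα : 0 < α) (hβ : 0 < β) (hlam : 0 < lam) (hφ : 0 < φ)
    {μ : Fin m → ℝ} {l : Fin n → ℝ} (hμ : MemQAbs lam φ α β μ) (hl : MemQAbs lam φ α β l)
    (hmaj : FrobMaj μ l) {x : ℝ} (hx : xHatUpper lam φ α β < ((|x| : ℝ) : EReal)) :
    ∃ δ₀ > 0, ∀ δ ∈ Ioo 0 δ₀,
      expect α β (fun y => 1 - smoothTransition ((y - x) / δ)) l ≤
        expect α β (fun y => 1 - smoothTransition ((y - x) / δ)) μ := by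
  rcases le_or_gt 0 x with h0 | h0
  · refine ⟨1, one_pos, fun δ hδ => ?_⟩
    rw [abs_of_nonneg h0] at hx
    exact expect_le_of_frobMaj hα hβ hlam hφ hμ hl hmaj
      (isTestFunction_smoothTransition x hδ.1) hx
  · rw [abs_of_neg h0] at hx
    obtain ⟨y, hy1, hy2⟩ := EReal.lt_iff_exists_real_btwn.1 hx
    rw [EReal.coe_lt_coe_iff] at hy2
    refine ⟨-x - y, by linarith, fun δ hδ => ?_⟩
    have ht := isTestFunction_smoothTransition x hδ.1
    have hlt : xHatUpper lam φ α β < ((-(x + δ) : ℝ) : EReal) :=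
      hy1.trans (EReal.coe_lt_coe_iff.2 (by linarith [hδ.2]))
    have := expect_le_of_frobMaj hα hβ hlam hφ (memQAbs_neg hα hβ hlam hl)
      (memQAbs_neg hα hβ hlam hμ) hmaj.neg ht.neg_comp_neg hlt
    rw [expect_neg hα hβ ht.contDiff.continuous, expect_neg hα hβ ht.contDiff.continuous] at this
    linarith

end Main

end GammaTail

theorem mainTheorem1 (α β lam φ : ℝ) (hα : 0 < α) (hβ : 0 < β) (hlam : 0 < lam)
    (hlamφ : lam ≤ φ / Real.sqrt α) {m n : ℕ} (μ : Fin m → ℝ) (l : Fin n → ℝ)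
    (hμ : GammaTail.MemQAbs lam φ α β μ) (hl : GammaTail.MemQAbs lam φ α β l)
    (hmaj : GammaTail.FrobMaj μ l) :
    ∀ x : ℝ, GammaTail.xHatUpper lam φ α β < ((|x| : ℝ) : EReal) →
      GammaTail.centeredCDF α β l x ≤ GammaTail.centeredCDF α β μ x := by
  intro x hx
  have hφ : 0 < φ := by
    have h1 : 0 < φ / √α := hlam.trans_le hlamφ
    have h2 := mul_pos h1 (Real.sqrt_pos.2 hα)
    rwa [div_mul_cancel₀ _ (Real.sqrt_pos.2 hα).ne'] at h2
  obtain ⟨δ₀, hδ₀, hle⟩ :=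
    GammaTail.exists_expect_smoothTransition_le hα hβ hlam hφ hμ hl hmaj hx
  have hbound : ∀ δ ∈ Set.Ioo 0 δ₀,
      GammaTail.centeredCDF α β l x ≤ GammaTail.centeredCDF α β μ (x + δ) := by
    intro δ hδ
    have hc : Continuous fun y => 1 - Real.smoothTransition ((y - x) / δ) :=
      continuous_const.sub (Real.smoothTransition.continuous.comp (by fun_prop))
    have h0 : ∀ y, 0 ≤ 1 - Real.smoothTransition ((y - x) / δ) := fun y =>
      sub_nonneg.2 (Real.smoothTransition.le_one _)
    have h1 : ∀ y, 1 - Real.smoothTransition ((y - x) / δ) ≤ 1 := fun y =>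
      sub_le_self _ (Real.smoothTransition.nonneg _)
    refine (GammaTail.centeredCDF_le_expect hα hβ l x hc h0 h1 fun y hy => ?_).trans
      ((hle δ hδ).trans
        (GammaTail.expect_le_centeredCDF hα hβ μ (x + δ) hc h0 h1 fun y hy => ?_))
    · rw [Real.smoothTransition.zero_of_nonpos
        (div_nonpos_of_nonpos_of_nonneg (by linarith) hδ.1.le), sub_zero]
    · rw [Real.smoothTransition.one_of_one_le (by rw [le_div_iff₀ hδ.1]; linarith), sub_self]
  simp_rw [GammaTail.centeredCDF_eq_cdf hα hβ μ] at hbound ⊢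
  set c := x + GammaTail.QMean α β μ with hcdef
  have hright := (cdf (GammaTail.QLaw α β μ)).right_continuous c
  have hshift : Filter.Tendsto (fun δ : ℝ => x + δ + GammaTail.QMean α β μ)
      (nhdsWithin 0 (Set.Ioi 0)) (nhdsWithin c (Set.Ici c)) := by
    refine tendsto_nhdsWithin_iff.2 ⟨?_, ?_⟩
    · have : Continuous fun δ : ℝ => x + δ + GammaTail.QMean α β μ := by fun_prop
      have h := (this.tendsto 0).mono_left (nhdsWithin_le_nhds (s := Set.Ioi 0))
      simpa [hcdef] using h
    · filter_upwards [self_mem_nhdsWithin] with δ hδ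
      have hδ : 0 < δ := hδ
      simp only [Set.mem_Ici, hcdef]
      linarith
  refine ge_of_tendsto (hright.tendsto.comp hshift) ?_
  filter_upwards [Ioo_mem_nhdsGT hδ₀] with δ hδ using hbound δ hδ
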